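/- Let $\mathbb{D}$ be the open unit disc of $\mathbb{C}$. Let $A$ be analytic in $\mathbb{D}$ with $\sup_{z\in\mathbb{D}}|A(z)|(1-|z|^2)^2<\infty$ (that is, $A\in H^\infty_2$), and let $f$ be an analytic solution of $f''+Af=0$ in $\mathbb{D}$ whose set of zeros $\Lambda\subset\mathbb{D}$ (possibly empty or finite) is uniformly separated. This means that there is $0<\delta<1$ with $|z-w|/|1-\overline{z}w|>\delta$ for all distinct $z,w\in\Lambda$, and that $\sum_{z_n\in\Lambda}(1-|z_n|)\delta_{z_n}$ is a Carleson measure, i.e. $\sup_{a\in\mathbb{D}}\sum_{z_n\in\Lambda}(1-|z_n|)\,|\varphi_a'(z_n)|<\infty$, where $\varphi_a(z)=(a-z)/(1-\overline{a}z)$. Then $f$ can be factorized as $f=Be^g$ in $\mathbb{D}$, where $B$ is the Blaschke product with simple zeros exactly at the points of $\Lambda$, and $g$ is an analytic function in $\mathbb{D}$ that belongs to the Bloch space, i.e. $\|g\|_{\mathcal{B}}=\sup_{z\in\mathbb{D}}|g'(z)|(1-|z|^2)<\infty$, and satisfies $$g'(z_n)=-\frac12\,\frac{B''(z_n)}{B'(z_n)},\qquad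 z_n\in\Lambda .$$ Moreover, for every such factorization and every $0<p<\infty$, $$\sup_{0<r<1}\left(\frac1{2\pi}\int_0^{2\pi}|f(re^{i\theta})|^p\,d\theta\right)^{1/p}(1-r)^{p\,\|g\|_{\mathcal{B}}^2}<\infty .$$ -/

import Mathlib

open MeasureTheory
open scoped NNReal ENNReal ComplexConjugate

noncomputable section

/-- The open unit disc of the complex plane. -/
def unitDisk : Set ℂ := Metric.ball 0 1

/-- The disc automorphism `φ_a(z) = (a - z) / (1 - conj a * z)`. -/
def diskAut (a z : ℂ) : ℂ := (a - z) / (1 - conj a * z)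

/-- The pseudo-hyperbolic distance `|z - w| / |1 - conj z * w|`. -/
def pseudoHyperbolicDist (z w : ℂ) : ℝ := ‖z - w‖ / ‖1 - conj z * w‖

/-- Separation of a set of points in the hyperbolic metric. -/
def IsHyperbolicallySeparated (Λ : Set ℂ) : Prop :=
  ∃ δ : ℝ, 0 < δ ∧ δ < 1 ∧ ∀ z ∈ Λ, ∀ w ∈ Λ, z ≠ w → δ < pseudoHyperbolicDist z w

/-- Carleson measures on the unit disc: `sup_a ∫ |φ_a'(z)| dμ(z) < ∞`, where `a` ranges over the
disc and the integral is over the disc. -/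
def IsCarlesonMeasure (μ : Measure ℂ) : Prop :=
  ∃ C : ℝ≥0, ∀ a ∈ unitDisk, ∫⁻ z in unitDisk, ‖deriv (diskAut a) z‖ₑ ∂μ ≤ C

/-- The measure `∑_{a ∈ Λ} (1 - |a|) δ_a`. -/
def pointMassMeasure (Λ : Set ℂ) : Measure ℂ :=
  Measure.sum fun a : Λ => ENNReal.ofReal (1 - ‖(a : ℂ)‖) • Measure.dirac (a : ℂ)

/-- Uniformly separated sets of points of the unit disc. -/
structure IsUniformlySeparated (Λ : Set ℂ) : Prop where
  subset_unitDisk : Λ ⊆ unitDisk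
  separated : IsHyperbolicallySeparated Λ
  carleson : IsCarlesonMeasure (pointMassMeasure Λ)

/-- The zeros of `f` in the unit disc. -/
def diskZeros (f : ℂ → ℂ) : Set ℂ := {z | z ∈ unitDisk ∧ f z = 0}

/-- The growth space `H^∞_α`. -/
def MemGrowthSpace (α : ℝ) (A : ℂ → ℂ) : Prop :=
  DifferentiableOn ℂ A unitDisk ∧
    BddAbove ((fun z : ℂ => ‖A z‖ * (1 - ‖z‖ ^ 2) ^ α) '' unitDisk)

/-- The Bloch space. -/
def MemBloch (g : ℂ → ℂ) : Prop :=
  DifferentiableOn ℂ g unitDisk ∧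
    BddAbove ((fun z : ℂ => ‖deriv g z‖ * (1 - ‖z‖ ^ 2)) '' unitDisk)

/-- The Bloch (semi)norm `sup_{|z| < 1} |g'(z)| (1 - |z|^2)` of a function in the Bloch space. -/
def blochNorm (g : ℂ → ℂ) : ℝ :=
  sSup ((fun z : ℂ => ‖deriv g z‖ * (1 - ‖z‖ ^ 2)) '' unitDisk)

/-- Analytic solutions in the unit disc of `f'' + A f = 0`. -/
def IsSolution (A f : ℂ → ℂ) : Prop :=
  DifferentiableOn ℂ f unitDisk ∧ ∀ z ∈ unitDisk, deriv (deriv f) z + A z * f z = 0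

open Classical in
/-- The normalized Blaschke factor with its zero at `a`. -/
def blaschkeFactor (a z : ℂ) : ℂ :=
  if a = 0 then z else ((‖a‖ : ℂ) / a) * ((a - z) / (1 - conj a * z))

/-- On the unit disc, `B` is the Blaschke product whose zeros are the points of `Λ`, each of
multiplicity one. -/
structure IsBlaschkeProduct (Λ : Set ℂ) (B : ℂ → ℂ) : Prop where
  subset_unitDisk : Λ ⊆ unitDisk
  blaschke_condition : Summable fun a : Λ => 1 - ‖(a : ℂ)‖
  hasProd : HasProdLocallyUniformlyOn (fun (a : Λ) (z : ℂ) => blaschkeFactor a z) B unitDisk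

/-- The factorization `f = B e^g` in the unit disc: `B` is the Blaschke product with the zeros
of `f`, and `g` is a Bloch function with `g' = - B'' / (2 B')` at these zeros. -/
structure IsBlaschkeBlochFactorization (f B g : ℂ → ℂ) : Prop where
  blaschke : IsBlaschkeProduct (diskZeros f) B
  bloch : MemBloch g
  interpolation : ∀ z ∈ diskZeros f,
    deriv B z ≠ 0 ∧ deriv g z = -(1 / 2) * (deriv (deriv B) z / deriv B z)
  eq_mul_exp : ∀ z ∈ unitDisk, f z = B z * Complex.exp (g z)

/-- The integral mean `M_p(r, f)`. -/
def integralMean (p r : ℝ) (f : ℂ → ℂ) : ℝ :=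
  (1 / (2 * Real.pi) *
    ∫ θ in (0 : ℝ)..(2 * Real.pi), ‖f (r * Complex.exp (θ * Complex.I))‖ ^ p) ^ (1 / p)

end

open Filter Topology Set

/-! Factorization. Since `A` is of order `(1 - |z|)⁻²`, on a disc about `c` of radius `t (1 - |c|)`
with `t` small a solution differs little from its first Taylor polynomial
(`IsSolution.exists_scale`). Hence a multiple zero would make `f` vanish on a whole disc, which
separation forbids, so the zeros are simple; and where such a disc is free of zeros, `f'/f` is `O(1
/ (1 - |c|))`. The quotient of `f` by the Blaschke product `B` is therefore analytic and zero-free,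
that is, `e^g`. Now `g' = f'/f - B'/B`: away from the zeros the first term is bounded as above and
the second by the Carleson condition, and separation lets the maximum principle fill in discs around
the zeros (`norm_mul_le_of_separated`). The interpolation condition is `f'' = -A f = 0` at a zero,
written in terms of `B` and `g`.

Growth. As `|B| ≤ 1`, `|f|^p ≤ |F|²` with `F = e^{pg/2}`, and `|F'| ≤ b |F| / (1 - |z|²)` with `b =
p ‖g‖ / 2`. By Parseval the quadratic mean of `F` is a power series `φ` in `x = r²` with nonnegative
coefficients, and that of `F'` is `(x φ')'`. The resulting inequality `(x φ')' ≤ b² φ / (1 - x)²`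
integrates to `φ(x) ≤ φ(0) (1 - x)^{-b²}`. -/

theorem mem_unitDisk {z : ℂ} : z ∈ unitDisk ↔ ‖z‖ < 1 := by
  simp [unitDisk]

theorem isOpen_unitDisk : IsOpen unitDisk := Metric.isOpen_ball

/-! ### Disc automorphisms and Blaschke factors. -/

theorem one_sub_norm_le_norm_one_sub_conj_mul {a z : ℂ} (ha : ‖a‖ ≤ 1) :
    1 - ‖z‖ ≤ ‖1 - conj a * z‖ := by
  have h1 : ‖(1 : ℂ)‖ - ‖conj a * z‖ ≤ ‖1 - conj a * z‖ := norm_sub_norm_le _ _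
  rw [norm_mul, RCLike.norm_conj, norm_one] at h1
  nlinarith [norm_nonneg z]

theorem one_sub_conj_mul_ne_zero {a z : ℂ} (ha : ‖a‖ ≤ 1) (hz : ‖z‖ < 1) :
    1 - conj a * z ≠ 0 := by
  rw [← norm_pos_iff]
  linarith [one_sub_norm_le_norm_one_sub_conj_mul (z := z) ha]

theorem norm_one_sub_conj_mul_comm (a z : ℂ) : ‖1 - conj a * z‖ = ‖1 - conj z * a‖ := by
  rw [← RCLike.norm_conj]
  simp [mul_comm]

theorem hasDerivAt_diskAut {a z : ℂ} (ha : ‖a‖ ≤ 1) (hz : ‖z‖ < 1) :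
    HasDerivAt (diskAut a) (-(1 - (‖a‖ : ℂ) ^ 2) / (1 - conj a * z) ^ 2) z := by
  have h0 := one_sub_conj_mul_ne_zero ha hz
  have h1 : HasDerivAt (fun z : ℂ => a - z) (-1) z := (hasDerivAt_id z).const_sub a
  have h2 : HasDerivAt (fun z : ℂ => 1 - conj a * z) (-conj a) z := by
    simpa using ((hasDerivAt_id z).const_mul (conj a)).const_sub 1
  have h3 := h1.div h2 h0
  have h4 : (‖a‖ : ℂ) ^ 2 = conj a * a := by
    rw [← Complex.mul_conj', mul_comm]
  convert! h3 using 1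
  rw [h4]
  congr 1
  ring

theorem norm_deriv_diskAut {a z : ℂ} (ha : ‖a‖ ≤ 1) (hz : ‖z‖ < 1) :
    ‖deriv (diskAut a) z‖ = (1 - ‖a‖ ^ 2) / ‖1 - conj a * z‖ ^ 2 := by
  rw [(hasDerivAt_diskAut ha hz).deriv, norm_div, norm_neg, norm_pow]
  congr 1
  have : (1 - (‖a‖ : ℂ) ^ 2) = ((1 - ‖a‖ ^ 2 : ℝ) : ℂ) := by push_cast; ring
  rw [this, Complex.norm_real, Real.norm_of_nonneg]
  nlinarith [norm_nonneg a]

/-- The unimodular constant relating a Blaschke factor to the disc automorphism. -/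
theorem exists_blaschkeFactor_eq (a : ℂ) :
    ∃ u : ℂ, ‖u‖ = 1 ∧ ∀ z, blaschkeFactor a z = u * diskAut a z := by
  by_cases h : a = 0
  · exact ⟨-1, by simp, fun z => by simp [blaschkeFactor, diskAut, h]⟩
  · refine ⟨(‖a‖ : ℂ) / a, ?_, fun z => by simp [blaschkeFactor, diskAut, h]⟩
    simp [h]

theorem norm_blaschkeFactor (a z : ℂ) :
    ‖blaschkeFactor a z‖ = ‖a - z‖ / ‖1 - conj a * z‖ := by
  obtain ⟨u, hu, h⟩ := exists_blaschkeFactor_eq a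
  rw [h, norm_mul, hu, one_mul, diskAut, norm_div]

theorem differentiableAt_blaschkeFactor {a z : ℂ} (ha : ‖a‖ ≤ 1) (hz : ‖z‖ < 1) :
    DifferentiableAt ℂ (blaschkeFactor a) z := by
  obtain ⟨u, hu, h⟩ := exists_blaschkeFactor_eq a
  rw [funext h]
  exact (hasDerivAt_diskAut ha hz).differentiableAt.const_mul u

theorem norm_deriv_blaschkeFactor {a z : ℂ} (ha : ‖a‖ ≤ 1) (hz : ‖z‖ < 1) :
    ‖deriv (blaschkeFactor a) z‖ = (1 - ‖a‖ ^ 2) / ‖1 - conj a * z‖ ^ 2 := by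
  obtain ⟨u, hu, h⟩ := exists_blaschkeFactor_eq a
  rw [funext h, deriv_const_mul u (hasDerivAt_diskAut ha hz).differentiableAt, norm_mul, hu,
    one_mul, norm_deriv_diskAut ha hz]

theorem norm_sub_le_norm_one_sub_conj_mul {a z : ℂ} (ha : ‖a‖ ≤ 1) (hz : ‖z‖ ≤ 1) :
    ‖a - z‖ ≤ ‖1 - conj a * z‖ := by
  refine le_of_sq_le_sq ?_ (norm_nonneg _) 
  have e1 : ‖a‖ ^ 2 = a.re ^ 2 + a.im ^ 2 := by
    rw [← Complex.normSq_eq_norm_sq, Complex.normSq_apply]; ring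
  have e2 : ‖z‖ ^ 2 = z.re ^ 2 + z.im ^ 2 := by
    rw [← Complex.normSq_eq_norm_sq, Complex.normSq_apply]; ring
  have h1 : ‖a‖ ^ 2 ≤ 1 := by nlinarith [norm_nonneg a]
  have h2 : ‖z‖ ^ 2 ≤ 1 := by nlinarith [norm_nonneg z]
  have key : ‖1 - conj a * z‖ ^ 2 - ‖a - z‖ ^ 2 = (1 - ‖a‖ ^ 2) * (1 - ‖z‖ ^ 2) := by
    rw [e1, e2, ← Complex.normSq_eq_norm_sq, ← Complex.normSq_eq_norm_sq, Complex.normSq_apply,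
      Complex.normSq_apply]
    simp
    ring
  nlinarith [mul_nonneg (sub_nonneg.2 h1) (sub_nonneg.2 h2)]

theorem norm_blaschkeFactor_le_one {a z : ℂ} (ha : ‖a‖ ≤ 1) (hz : ‖z‖ < 1) :
    ‖blaschkeFactor a z‖ ≤ 1 := by
  rw [norm_blaschkeFactor]
  exact div_le_one_of_le₀ (norm_sub_le_norm_one_sub_conj_mul ha hz.le) (norm_nonneg _)

theorem blaschkeFactor_eq_zero_iff {a z : ℂ} (ha : ‖a‖ ≤ 1) (hz : ‖z‖ < 1) :
    blaschkeFactor a z = 0 ↔ z = a := by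
  rw [← norm_eq_zero, norm_blaschkeFactor, div_eq_zero_iff, norm_eq_zero, norm_eq_zero,
    or_iff_left (one_sub_conj_mul_ne_zero ha hz), sub_eq_zero, eq_comm]

/-- A deviation from 1 linear in `1 - ‖a‖`, locally uniformly in `z`, is what turns the Blaschke
condition into convergence of the product and its non-vanishing off `Λ`. -/
theorem norm_blaschkeFactor_sub_one_le {a z : ℂ} (ha : ‖a‖ ≤ 1) (hz : ‖z‖ < 1) :
    ‖blaschkeFactor a z - 1‖ ≤ (1 - ‖a‖) * (2 / (1 - ‖z‖)) := by
  have hz' : 0 < 1 - ‖z‖ := by linarith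
  by_cases h : a = 0
  · have h1 : ‖z - 1‖ ≤ 2 := (norm_sub_le _ _).trans (by rw [norm_one]; linarith)
    have h2 : (2 : ℝ) ≤ 2 / (1 - ‖z‖) := by
      rw [le_div_iff₀ hz']; linarith [norm_nonneg z]
    simpa [blaschkeFactor, h] using h1.trans h2
  · have h0 := one_sub_conj_mul_ne_zero ha hz
    have h4 : (‖a‖ : ℂ) ^ 2 = conj a * a := by rw [← Complex.mul_conj', mul_comm]
    have e : blaschkeFactor a z - 1 =
        -((1 - ‖a‖ : ℝ) : ℂ) * ((a + ‖a‖ * z) / (a * (1 - conj a * z))) := by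
      simp only [blaschkeFactor, h, if_false]
      have h5 : a * (1 - conj a * z) ≠ 0 := mul_ne_zero h h0
      rw [div_mul_div_comm, mul_div_assoc', div_sub_one h5, div_left_inj' h5]
      push_cast
      linear_combination (-z) * h4
    have h3 : ‖a + ‖a‖ * z‖ ≤ 2 * ‖a‖ := by
      refine (norm_add_le _ _).trans ?_
      rw [norm_mul, Complex.norm_real, norm_norm]
      nlinarith [norm_nonneg a]
    rw [e, norm_mul, norm_neg, Complex.norm_real, Real.norm_of_nonneg (by linarith), norm_div,
      norm_mul]
    refine mul_le_mul_of_nonneg_left ?_ (by linarith)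
    have ha0 : 0 < ‖a‖ := norm_pos_iff.2 h
    have h5 := one_sub_norm_le_norm_one_sub_conj_mul (z := z) ha
    rw [div_le_div_iff₀ (mul_pos ha0 (hz'.trans_le h5)) hz']
    calc ‖a + ‖a‖ * z‖ * (1 - ‖z‖) ≤ (2 * ‖a‖) * ‖1 - conj a * z‖ := by gcongr
      _ = _ := by ring

/-! ### Blaschke products with simple zeros. -/

theorem hasProdLocallyUniformlyOn_blaschkeFactor {Λ : Set ℂ} (hΛ : Λ ⊆ unitDisk)
    (hs : Summable fun a : Λ => 1 - ‖(a : ℂ)‖) :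
    HasProdLocallyUniformlyOn (fun (a : Λ) (z : ℂ) => blaschkeFactor a z)
      (fun z => ∏' a : Λ, blaschkeFactor a z) unitDisk := by
  refine hasProdLocallyUniformlyOn_of_forall_compact isOpen_unitDisk fun K hK hKc => ?_
  have hle : ∀ a : Λ, ‖(a : ℂ)‖ ≤ 1 := fun a => (mem_unitDisk.1 (hΛ a.2)).le
  obtain ⟨r, hr, hKr⟩ : ∃ r < 1, ∀ z ∈ K, ‖z‖ ≤ r := by
    rcases K.eq_empty_or_nonempty with rfl | hne
    · exact ⟨0, by simp, by simp⟩
    · obtain ⟨w, hw, hmax⟩ := hKc.exists_isMaxOn hne continuous_norm.continuousOn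
      exact ⟨‖w‖, mem_unitDisk.1 (hK hw), fun z hz => hmax hz⟩
  have := Summable.hasProdUniformlyOn_one_add (f := fun (a : Λ) z => blaschkeFactor a z - 1) hKc
    (hs.mul_right (2 / (1 - r))) (Eventually.of_forall fun a z hz => ?_) fun a => ?_
  · simpa using this
  · refine (norm_blaschkeFactor_sub_one_le (hle a) (mem_unitDisk.1 (hK hz))).trans ?_
    have := hle a
    have := hKr z hz
    gcongr
  · exact fun z hz => ((differentiableAt_blaschkeFactor (hle a)
      (mem_unitDisk.1 (hK hz))).continuousAt.sub continuousAt_const).continuousWithinAt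

theorem tprod_blaschkeFactor_ne_zero {Λ : Set ℂ} (hΛ : Λ ⊆ unitDisk)
    (hs : Summable fun a : Λ => 1 - ‖(a : ℂ)‖) {z : ℂ} (hz : z ∈ unitDisk) (hzΛ : z ∉ Λ) :
    ∏' a : Λ, blaschkeFactor a z ≠ 0 := by
  have hle : ∀ a : Λ, ‖(a : ℂ)‖ ≤ 1 := fun a => (mem_unitDisk.1 (hΛ a.2)).le
  have hz' := mem_unitDisk.1 hz
  have := tprod_one_add_ne_zero_of_summable (f := fun a : Λ => blaschkeFactor a z - 1)
    (fun a => ?_) ?_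
  · simpa using this
  · simp only [add_sub_cancel, ne_eq, blaschkeFactor_eq_zero_iff (hle a) hz']
    rintro rfl
    exact hzΛ a.2
  · exact (hs.mul_right (2 / (1 - ‖z‖))).of_nonneg_of_le (fun _ => norm_nonneg _)
      fun a => norm_blaschkeFactor_sub_one_le (hle a) hz'

theorem hasProd_subtype_of_sdiff_singleton {f : ℂ → ℂ} {s : Set ℂ} {a m : ℂ} (ha : a ∈ s)
    (h : HasProd (fun b : (s \ {a} : Set ℂ) => f b) m) :
    HasProd (fun b : s => f b) (f a * m) := by
  have h3 : HasProd (fun b : ({a} : Set ℂ) => f b) (f a) := by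
    simpa using hasProd_unique (fun b : ({a} : Set ℂ) => f b)
  have h4 := HasProd.mul_disjoint (f := f) disjoint_sdiff_right h3 h
  have h5 : {a} ∪ s \ {a} = s := by simp [Set.insert_eq_of_mem ha]
  rwa [h5] at h4

namespace IsBlaschkeProduct

variable {Λ : Set ℂ} {B : ℂ → ℂ}

theorem norm_le_one_of_mem (hB : IsBlaschkeProduct Λ B) (a : Λ) : ‖(a : ℂ)‖ ≤ 1 :=
  (mem_unitDisk.1 (hB.subset_unitDisk a.2)).le

theorem eq_tprod (hB : IsBlaschkeProduct Λ B) {z : ℂ} (hz : z ∈ unitDisk) :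
    B z = ∏' a : Λ, blaschkeFactor a z :=
  (hB.hasProd.hasProd hz).tprod_eq.symm

theorem differentiableOn_prod (hB : IsBlaschkeProduct Λ B) (s : Finset Λ) :
    DifferentiableOn ℂ (fun z => ∏ a ∈ s, blaschkeFactor a z) unitDisk :=
  DifferentiableOn.fun_finsetProd fun a _ _ hz => (differentiableAt_blaschkeFactor
    (hB.norm_le_one_of_mem a) (mem_unitDisk.1 hz)).differentiableWithinAt

theorem differentiableOn (hB : IsBlaschkeProduct Λ B) : DifferentiableOn ℂ B unitDisk :=
  TendstoLocallyUniformlyOn.differentiableOn hB.hasProd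
    (Eventually.of_forall hB.differentiableOn_prod) isOpen_unitDisk

theorem norm_le_one (hB : IsBlaschkeProduct Λ B) {z : ℂ} (hz : z ∈ unitDisk) : ‖B z‖ ≤ 1 := by
  refine le_of_tendsto (hB.hasProd.hasProd hz).norm (Eventually.of_forall fun s => ?_)
  simp only
  exact Finset.prod_le_one (fun _ _ => norm_nonneg _)
    fun a _ => norm_blaschkeFactor_le_one (hB.norm_le_one_of_mem a) (mem_unitDisk.1 hz)

theorem ne_zero (hB : IsBlaschkeProduct Λ B) {z : ℂ} (hz : z ∈ unitDisk) (hzΛ : z ∉ Λ) :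
    B z ≠ 0 := by
  rw [hB.eq_tprod hz]
  exact tprod_blaschkeFactor_ne_zero hB.subset_unitDisk hB.blaschke_condition hz hzΛ

/-- The cofactor is a Blaschke product not vanishing at `a`, so the zero of `B` there is exactly
that of one factor, hence simple. -/
theorem exists_eq_mul (hB : IsBlaschkeProduct Λ B) {a : ℂ} (ha : a ∈ Λ) :
    ∃ B₁ : ℂ → ℂ, IsBlaschkeProduct (Λ \ {a}) B₁ ∧
      ∀ z ∈ unitDisk, B z = blaschkeFactor a z * B₁ z := by
  have hsub : Λ \ {a} ⊆ unitDisk := sdiff_subset.trans hB.subset_unitDisk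
  have hs : Summable fun b : (Λ \ {a} : Set ℂ) => 1 - ‖(b : ℂ)‖ :=
    Summable.comp_injective (i := Set.inclusion (sdiff_subset : Λ \ {a} ⊆ Λ))
      hB.blaschke_condition (Set.inclusion_injective _)
  have h1 := hasProdLocallyUniformlyOn_blaschkeFactor hsub hs
  refine ⟨fun z => ∏' b : (Λ \ {a} : Set ℂ), blaschkeFactor b z, ⟨hsub, hs, h1⟩, fun z hz => ?_⟩
  have h2 := hasProd_subtype_of_sdiff_singleton (f := fun b => blaschkeFactor b z) ha
    (h1.hasProd hz)
  exact HasProd.unique (hB.hasProd.hasProd hz) h2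

theorem eq_zero_iff (hB : IsBlaschkeProduct Λ B) {z : ℂ} (hz : z ∈ unitDisk) :
    B z = 0 ↔ z ∈ Λ := by
  refine ⟨fun h => by_contra fun h' => hB.ne_zero hz h' h, fun h => ?_⟩
  obtain ⟨B₁, -, hB₁⟩ := hB.exists_eq_mul h
  rw [hB₁ z hz, (blaschkeFactor_eq_zero_iff (mem_unitDisk.1 hz).le (mem_unitDisk.1 hz)).2 rfl,
    zero_mul]

theorem deriv_ne_zero (hB : IsBlaschkeProduct Λ B) {a : ℂ} (ha : a ∈ Λ) : deriv B a ≠ 0 := by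
  obtain ⟨B₁, hB₁, h⟩ := hB.exists_eq_mul ha
  have haD := hB.subset_unitDisk ha
  have ha1 := mem_unitDisk.1 haD
  have hev : B =ᶠ[𝓝 a] fun z => blaschkeFactor a z * B₁ z := by
    filter_upwards [isOpen_unitDisk.mem_nhds haD] with z hz using h z hz
  have hb := differentiableAt_blaschkeFactor ha1.le ha1
  rw [hev.deriv_eq, deriv_fun_mul hb
    (hB₁.differentiableOn.differentiableAt (isOpen_unitDisk.mem_nhds haD)),
    (blaschkeFactor_eq_zero_iff ha1.le ha1).2 rfl, zero_mul, add_zero]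
  refine mul_ne_zero ?_ (hB₁.ne_zero haD (by simp))
  rw [← norm_pos_iff, norm_deriv_blaschkeFactor ha1.le ha1]
  have := norm_pos_iff.2 (one_sub_conj_mul_ne_zero ha1.le ha1)
  have : 0 < 1 - ‖a‖ ^ 2 := by nlinarith [norm_nonneg a]
  positivity

end IsBlaschkeProduct

/-! ### The Carleson condition and the logarithmic derivative of the Blaschke product. -/

theorem lintegral_pointMassMeasure {Λ : Set ℂ} (hΛ : Λ ⊆ unitDisk) (φ : ℂ → ℝ≥0∞) :
    ∫⁻ z in unitDisk, φ z ∂pointMassMeasure Λ =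
      ∑' a : Λ, ENNReal.ofReal (1 - ‖(a : ℂ)‖) * φ a := by
  classical
  have hm : MeasurableSet unitDisk := isOpen_unitDisk.measurableSet
  rw [pointMassMeasure, Measure.restrict_sum _ hm, lintegral_sum_measure]
  refine tsum_congr fun a => ?_
  rw [Measure.restrict_smul, restrict_dirac' hm, if_pos (hΛ a.2)]
  simp

theorem IsCarlesonMeasure.exists_sum_le {Λ : Set ℂ} (hΛ : Λ ⊆ unitDisk)
    (h : IsCarlesonMeasure (pointMassMeasure Λ)) :
    ∃ C : ℝ, 0 ≤ C ∧ ∀ a ∈ unitDisk, ∀ s : Finset Λ,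
      ∑ z ∈ s, (1 - ‖(z : ℂ)‖) * ((1 - ‖a‖ ^ 2) / ‖1 - conj a * z‖ ^ 2) ≤ C := by
  obtain ⟨C, hC⟩ := h
  refine ⟨C, C.2, fun a ha s => ?_⟩
  have ha' := mem_unitDisk.1 ha
  have h1 := hC a ha
  rw [lintegral_pointMassMeasure hΛ] at h1
  have h2 := (ENNReal.sum_le_tsum s).trans h1
  have h3 : ∀ z : Λ, ENNReal.ofReal (1 - ‖(z : ℂ)‖) * ‖deriv (diskAut a) z‖ₑ =
      ENNReal.ofReal ((1 - ‖(z : ℂ)‖) * ((1 - ‖a‖ ^ 2) / ‖1 - conj a * z‖ ^ 2)) := fun z => by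
    have hz := mem_unitDisk.1 (hΛ z.2)
    rw [ENNReal.ofReal_mul (by linarith), ← norm_deriv_diskAut ha'.le hz, ofReal_norm]
  simp_rw [h3] at h2
  rw [← ENNReal.ofReal_sum_of_nonneg] at h2
  · exact (ENNReal.ofReal_le_iff_le_toReal (by simp)).1 h2
  · intro z _
    have hz := mem_unitDisk.1 (hΛ z.2)
    have : 0 ≤ 1 - ‖a‖ ^ 2 := by nlinarith [norm_nonneg a]
    have : 0 ≤ 1 - ‖(z : ℂ)‖ := by linarith
    positivity

theorem IsUniformlySeparated.summable {Λ : Set ℂ} (h : IsUniformlySeparated Λ) :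
    Summable fun a : Λ => 1 - ‖(a : ℂ)‖ := by
  obtain ⟨C, -, hC⟩ := h.carleson.exists_sum_le h.subset_unitDisk
  refine summable_of_sum_le (c := C) (fun a => ?_) fun s => ?_
  · have := mem_unitDisk.1 (h.subset_unitDisk a.2)
    simp only [Pi.zero_apply]; linarith
  -- At the parameter `0` the Carleson kernel is 1, leaving the Blaschke sum.
  · simpa using hC 0 (by simp [unitDisk]) s

/-- Away from `a` the factor is bounded below, so its logarithmic derivative is controlled by one
term of the Carleson sum, with `z` in the role of the parameter and `a` in that of the mass point.
-/
theorem norm_deriv_blaschkeFactor_mul_le {a z : ℂ} {t : ℝ} (ht : 0 < t) (ha : ‖a‖ < 1)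
    (hz : ‖z‖ < 1) (haz : t * (1 - ‖z‖) < ‖z - a‖) :
    ‖deriv (blaschkeFactor a) z‖ * (1 - ‖z‖ ^ 2) ≤
      2 * (2 / t + 1) * ((1 - ‖a‖) * ((1 - ‖z‖ ^ 2) / ‖1 - conj z * a‖ ^ 2)) *
        ‖blaschkeFactor a z‖ := by
  rw [norm_deriv_blaschkeFactor ha.le hz, norm_blaschkeFactor, norm_one_sub_conj_mul_comm a z]
  have hd : 0 < ‖1 - conj z * a‖ := norm_pos_iff.2 (one_sub_conj_mul_ne_zero hz.le ha)
  have hb : ‖1 - conj z * a‖ ≤ (2 / t + 1) * ‖a - z‖ := by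
    have e : 1 - conj z * a = ((1 - ‖z‖ ^ 2 : ℝ) : ℂ) + conj z * (z - a) := by
      have h4 : (‖z‖ : ℂ) ^ 2 = conj z * z := by rw [← Complex.mul_conj', mul_comm]
      push_cast
      rw [h4]; ring
    have h1 : ‖1 - conj z * a‖ ≤ (1 - ‖z‖ ^ 2) + ‖z - a‖ := by
      rw [e]
      refine (norm_add_le _ _).trans ?_
      rw [Complex.norm_real, Real.norm_of_nonneg (by nlinarith [norm_nonneg z]), norm_mul,
        RCLike.norm_conj]
      nlinarith [norm_nonneg (z - a)]
    have h2 : 1 - ‖z‖ ^ 2 ≤ 2 * (1 - ‖z‖) := by nlinarith [norm_nonneg z]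
    have h3 : 1 - ‖z‖ ≤ ‖z - a‖ / t := by rw [le_div_iff₀ ht]; linarith
    rw [norm_sub_rev a z]
    calc _ ≤ 2 * (‖z - a‖ / t) + ‖z - a‖ := by linarith
      _ = _ := by ring
  have hc : 1 ≤ (2 / t + 1) * (‖a - z‖ / ‖1 - conj z * a‖) := by
    rw [← mul_div_assoc, le_div_iff₀ hd]; linarith
  have h5 : 1 - ‖a‖ ^ 2 ≤ 2 * (1 - ‖a‖) := by nlinarith [norm_nonneg a]
  have h6 : 0 ≤ 1 - ‖z‖ ^ 2 := by nlinarith [norm_nonneg z]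
  have h7 : 0 ≤ (1 - ‖z‖ ^ 2) / ‖1 - conj z * a‖ ^ 2 := by positivity
  have h8 : 0 ≤ 1 - ‖a‖ := by linarith
  calc (1 - ‖a‖ ^ 2) / ‖1 - conj z * a‖ ^ 2 * (1 - ‖z‖ ^ 2)
      = (1 - ‖a‖ ^ 2) * ((1 - ‖z‖ ^ 2) / ‖1 - conj z * a‖ ^ 2) * 1 := by ring
    _ ≤ (2 * (1 - ‖a‖)) * ((1 - ‖z‖ ^ 2) / ‖1 - conj z * a‖ ^ 2) *
        ((2 / t + 1) * (‖a - z‖ / ‖1 - conj z * a‖)) := by gcongr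
    _ = _ := by ring

/-- Away from its zeros, the Blaschke product of a Carleson sequence has a logarithmic derivative
of order `1 / (1 - |z|)`. -/
theorem IsBlaschkeProduct.exists_norm_deriv_mul_le {Λ : Set ℂ} {B : ℂ → ℂ}
    (hB : IsBlaschkeProduct Λ B) (hc : IsCarlesonMeasure (pointMassMeasure Λ)) {t : ℝ}
    (ht : 0 < t) :
    ∃ K : ℝ, 0 ≤ K ∧ ∀ z ∈ unitDisk, (∀ a ∈ Λ, t * (1 - ‖z‖) < ‖z - a‖) →
      ‖deriv B z‖ * (1 - ‖z‖ ^ 2) ≤ K * ‖B z‖ := by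
  obtain ⟨C, hC0, hC⟩ := hc.exists_sum_le hB.subset_unitDisk
  refine ⟨2 * (2 / t + 1) * C, by positivity, fun z hz hza => ?_⟩
  have hz' := mem_unitDisk.1 hz
  have h1 : Tendsto (fun s : Finset Λ => deriv (fun z => ∏ a ∈ s, blaschkeFactor a z) z) atTop
      (𝓝 (deriv B z)) :=
    (TendstoLocallyUniformlyOn.deriv hB.hasProd (Eventually.of_forall hB.differentiableOn_prod)
      isOpen_unitDisk).tendsto_at hz
  -- The bound for finite products is kept in multiplied form, so it passes to the limit without
  -- dividing by `B z`.
  refine le_of_tendsto_of_tendsto (h1.norm.mul_const _)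
    ((hB.hasProd.hasProd hz).norm.const_mul _) (Eventually.of_forall fun s => ?_)
  have ha1 : ∀ a : Λ, ‖(a : ℂ)‖ < 1 := fun a => mem_unitDisk.1 (hB.subset_unitDisk a.2)
  have hne : ∀ a : Λ, blaschkeFactor a z ≠ 0 := fun a => by
    rw [Ne, blaschkeFactor_eq_zero_iff (ha1 a).le hz']
    rintro rfl
    have := hza _ a.2
    simp only [sub_self, norm_zero] at this
    nlinarith
  have hP : ∏ a ∈ s, blaschkeFactor a z ≠ 0 := Finset.prod_ne_zero_iff.2 fun a _ => hne a
  have h2 := logDeriv_prod (s := s) (f := fun (a : Λ) z => blaschkeFactor a z) (fun a _ => hne a)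
    fun a _ => differentiableAt_blaschkeFactor (ha1 a).le hz'
  rw [logDeriv_apply, div_eq_iff hP] at h2
  simp only at h2 ⊢
  rw [h2, norm_mul]
  have h6 : 0 ≤ 1 - ‖z‖ ^ 2 := by nlinarith [norm_nonneg z]
  rw [mul_right_comm]
  rw [← norm_prod]
  refine mul_le_mul_of_nonneg_right ?_ (norm_nonneg _)
  calc ‖∑ a ∈ s, logDeriv (fun z => blaschkeFactor (a : ℂ) z) z‖ * (1 - ‖z‖ ^ 2)
      ≤ ∑ a ∈ s, ‖logDeriv (blaschkeFactor (a : ℂ)) z‖ * (1 - ‖z‖ ^ 2) := by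
        rw [← Finset.sum_mul]; 
        exact mul_le_mul_of_nonneg_right (norm_sum_le _ _) h6
    _ ≤ ∑ a ∈ s, 2 * (2 / t + 1) *
        ((1 - ‖(a : ℂ)‖) * ((1 - ‖z‖ ^ 2) / ‖1 - conj z * a‖ ^ 2)) := by
        refine Finset.sum_le_sum fun (a : Λ) _ => ?_
        rw [logDeriv_apply, norm_div, div_mul_eq_mul_div, div_le_iff₀ (norm_pos_iff.2 (hne a))]
        exact norm_deriv_blaschkeFactor_mul_le ht (ha1 a) hz' (hza a a.2)
    _ ≤ 2 * (2 / t + 1) * C := by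
        rw [← Finset.mul_sum]
        gcongr
        exact hC z hz s

/-! ### Solutions on small hyperbolic discs; simplicity of zeros. -/

/-- First order Taylor estimate for solutions of `f'' + A f = 0` on a disc which is small compared
with the size of the coefficient. -/
theorem norm_sub_taylor_le_of_deriv_deriv_bound {f : ℂ → ℂ} {U : Set ℂ} (hU : IsOpen U)
    (hf : DifferentiableOn ℂ f U) {c : ℂ} {R N : ℝ} (hR : 0 ≤ R) (hN : 0 ≤ N)
    (hsub : Metric.closedBall c R ⊆ U)
    (h2 : ∀ z ∈ Metric.closedBall c R, ‖deriv (deriv f) z‖ ≤ N * ‖f z‖) (hNR : N * R ^ 2 ≤ 1 / 4)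
    {z : ℂ} (hz : z ∈ Metric.closedBall c R) :
    ‖f z - f c - deriv f c * (z - c)‖ ≤ 1 / 3 * (‖f c‖ + ‖deriv f c‖ * R) := by
  have hcB : c ∈ Metric.closedBall c R := Metric.mem_closedBall_self hR
  have hconv := convex_closedBall c R
  obtain ⟨w, hw, hmax⟩ := (isCompact_closedBall c R).exists_isMaxOn ⟨c, hcB⟩
    (hf.continuousOn.mono hsub).norm
  have hm : ∀ z ∈ Metric.closedBall c R, ‖f z‖ ≤ ‖f w‖ := fun z hz => hmax hz
  have hd : DifferentiableOn ℂ (deriv f) U := hf.deriv hU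
  have hdist : ∀ z ∈ Metric.closedBall c R, ‖z - c‖ ≤ R := fun z hz => by
    simpa [dist_eq_norm] using hz
  have h3 : ∀ z ∈ Metric.closedBall c R, ‖deriv f z - deriv f c‖ ≤ N * ‖f w‖ * R := by
    intro z hz
    refine (hconv.norm_image_sub_le_of_norm_deriv_le (f := deriv f) (C := N * ‖f w‖)
      (fun x hx => hd.differentiableAt (hU.mem_nhds (hsub hx)))
      (fun x hx => (h2 x hx).trans (mul_le_mul_of_nonneg_left (hm x hx) hN)) hcB hz).trans ?_
    exact mul_le_mul_of_nonneg_left (hdist z hz) (by positivity)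
  have h4 : ∀ z ∈ Metric.closedBall c R,
      ‖f z - f c - deriv f c * (z - c)‖ ≤ N * R ^ 2 * ‖f w‖ := by
    intro z hz
    have hder : ∀ x ∈ Metric.closedBall c R,
        HasDerivWithinAt (fun y => f y - deriv f c * (y - c)) (deriv f x - deriv f c)
          (Metric.closedBall c R) x := fun x hx => by
      have e1 := (hf.differentiableAt (hU.mem_nhds (hsub hx))).hasDerivAt
      have e2 := ((hasDerivAt_id x).sub_const c).const_mul (deriv f c)
      simpa using (e1.fun_sub e2).hasDerivWithinAt
    have := hconv.norm_image_sub_le_of_norm_hasDerivWithin_le hder h3 hcB hz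
    simp only [sub_self, mul_zero, sub_zero] at this
    calc ‖f z - f c - deriv f c * (z - c)‖ = ‖f z - deriv f c * (z - c) - f c‖ := by
          congr 1; ring
      _ ≤ N * ‖f w‖ * R * ‖z - c‖ := this
      _ ≤ N * ‖f w‖ * R * R := mul_le_mul_of_nonneg_left (hdist z hz) (by positivity)
      _ = _ := by ring
  -- Absorbing the last term bounds the maximum `‖f w‖` by 4/3 of the linear part; the remainder is
  -- at most a quarter of that maximum, whence the 1/3.
  have h5 : ‖f w‖ ≤ ‖f c‖ + ‖deriv f c‖ * R + 1 / 4 * ‖f w‖ := by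
    have e1 : f w = f c + deriv f c * (w - c) + (f w - f c - deriv f c * (w - c)) := by ring
    have e2 : ‖f w‖ ≤ ‖f c‖ + ‖deriv f c * (w - c)‖ + ‖f w - f c - deriv f c * (w - c)‖ := by
      conv_lhs => rw [e1]
      exact norm_add₃_le
    have e3 : ‖deriv f c * (w - c)‖ ≤ ‖deriv f c‖ * R := by
      rw [norm_mul]; exact mul_le_mul_of_nonneg_left (hdist w hw) (norm_nonneg _)
    have e4 : N * R ^ 2 * ‖f w‖ ≤ 1 / 4 * ‖f w‖ := mul_le_mul_of_nonneg_right hNR (norm_nonneg _)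
    linarith [h4 w hw]
  have e4 : N * R ^ 2 * ‖f w‖ ≤ 1 / 4 * ‖f w‖ := mul_le_mul_of_nonneg_right hNR (norm_nonneg _)
  linarith [h4 z hz]

/-- A zero-free solution of `f'' + A f = 0` on a disc which is small compared with the size of the
coefficient has a bounded logarithmic derivative at the centre. -/
theorem norm_deriv_mul_le_of_deriv_deriv_bound {f : ℂ → ℂ} {U : Set ℂ} (hU : IsOpen U)
    (hf : DifferentiableOn ℂ f U) {c : ℂ} {R N : ℝ} (hR : 0 < R) (hN : 0 ≤ N)
    (hsub : Metric.closedBall c R ⊆ U)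
    (h2 : ∀ z ∈ Metric.closedBall c R, ‖deriv (deriv f) z‖ ≤ N * ‖f z‖) (hNR : N * R ^ 2 ≤ 1 / 4)
    (h0 : ∀ z ∈ Metric.closedBall c R, f z ≠ 0) :
    ‖deriv f c‖ * R ≤ 4 * ‖f c‖ := by
  by_contra! hlt
  -- By the Taylor estimate this number, with 2/3 = 1 - 1/3 and 4/3 = 1 + 1/3, bounds `‖f‖` from
  -- below on the circle. The maximum principle for `1/f` carries the bound to `c`, where the
  -- negated claim makes it fail.
  have hκ : 0 < 2 / 3 * (‖deriv f c‖ * R) - 4 / 3 * ‖f c‖ := by linarith [norm_nonneg (f c)]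
  have hcl : closure (Metric.ball c R) = Metric.closedBall c R := closure_ball c hR.ne'
  have hd : DiffContOnCl ℂ (fun z => (f z)⁻¹) (Metric.ball c R) := by
    refine DifferentiableOn.diffContOnCl ?_
    rw [hcl]
    exact (hf.mono hsub).fun_inv h0
  have hfr : ∀ z ∈ frontier (Metric.ball c R),
      ‖(f z)⁻¹‖ ≤ (2 / 3 * (‖deriv f c‖ * R) - 4 / 3 * ‖f c‖)⁻¹ := by
    intro z hz
    rw [frontier_ball c hR.ne'] at hz
    have h3 := norm_sub_taylor_le_of_deriv_deriv_bound hU hf hR.le hN hsub h2 hNR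
      (Metric.sphere_subset_closedBall hz)
    have hzc : ‖z - c‖ = R := by simpa [dist_eq_norm] using hz
    have h4 : ‖deriv f c * (z - c)‖ ≤ ‖f z‖ + ‖f c‖ + ‖f z - f c - deriv f c * (z - c)‖ := by
      have e : deriv f c * (z - c) = f z + -f c + -(f z - f c - deriv f c * (z - c)) := by ring
      calc _ = ‖f z + -f c + -(f z - f c - deriv f c * (z - c))‖ := by rw [← e]
        _ ≤ _ := by simpa only [norm_neg] using norm_add₃_le (a := f z) (b := -f c)
                      (c := -(f z - f c - deriv f c * (z - c)))
    rw [norm_mul, hzc] at h4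
    rw [norm_inv]
    exact inv_anti₀ hκ (by linarith)
  have := Complex.norm_le_of_forall_mem_frontier_norm_le Metric.isBounded_ball hd hfr
    (z := c) (subset_closure (Metric.mem_ball_self hR))
  rw [norm_inv] at this
  have := (inv_le_inv₀ (norm_pos_iff.2 (h0 c (Metric.mem_closedBall_self hR.le))) hκ).1 this
  linarith

theorem IsSolution.deriv_deriv_eq {A f : ℂ → ℂ} (hf : IsSolution A f) {z : ℂ}
    (hz : z ∈ unitDisk) : deriv (deriv f) z = -(A z * f z) :=
  eq_neg_of_add_eq_zero_left (hf.2 z hz)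

theorem closedBall_subset_unitDisk {c : ℂ} (hc : c ∈ unitDisk) {t : ℝ} (ht : t < 1) :
    Metric.closedBall c (t * (1 - ‖c‖)) ⊆ unitDisk := by
  intro z hz
  have hc' := mem_unitDisk.1 hc
  rw [Metric.mem_closedBall, dist_eq_norm] at hz
  have := norm_sub_norm_le z c
  rw [mem_unitDisk]
  nlinarith

theorem one_sub_mul_le_of_mem_closedBall {c z : ℂ} {t : ℝ}
    (hz : z ∈ Metric.closedBall c (t * (1 - ‖c‖))) : (1 - t) * (1 - ‖c‖) ≤ 1 - ‖z‖ := by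
  rw [Metric.mem_closedBall, dist_eq_norm] at hz
  have := norm_sub_norm_le z c
  linarith

theorem MemGrowthSpace.exists_norm_mul_sq_le {A : ℂ → ℂ} (hA : MemGrowthSpace 2 A) :
    ∃ M : ℝ, 0 ≤ M ∧ ∀ z ∈ unitDisk, ‖A z‖ * (1 - ‖z‖) ^ 2 ≤ M := by
  obtain ⟨M, hM⟩ := hA.2
  have h : ∀ z ∈ unitDisk, ‖A z‖ * (1 - ‖z‖) ^ 2 ≤ M := fun z hz => by
    have h1 := hM (mem_image_of_mem _ hz)
    have hz' := mem_unitDisk.1 hz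
    simp only [Real.rpow_two] at h1
    refine le_trans (mul_le_mul_of_nonneg_left (pow_le_pow_left₀ ?_ ?_ 2) (norm_nonneg _)) h1
    · linarith
    · nlinarith [norm_nonneg z]
  exact ⟨M, (by positivity : 0 ≤ ‖A 0‖ * (1 - ‖(0 : ℂ)‖) ^ 2).trans (h 0 (by simp [unitDisk])), h⟩

/-- Local behaviour of solutions of `f'' + A f = 0` with `A` of order `(1 - |z|)⁻²`, at the
scale of small hyperbolic discs. -/
theorem IsSolution.exists_scale {A f : ℂ → ℂ} (hf : IsSolution A f) (hA : MemGrowthSpace 2 A) :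
    ∃ t₀ : ℝ, 0 < t₀ ∧ t₀ ≤ 1 / 4 ∧ ∀ t, 0 < t → t ≤ t₀ → ∀ c ∈ unitDisk,
      ((∀ z ∈ Metric.closedBall c (t * (1 - ‖c‖)), f z ≠ 0) →
        ‖deriv f c‖ * (t * (1 - ‖c‖)) ≤ 4 * ‖f c‖) ∧
      (f c = 0 → deriv f c = 0 → ∀ z ∈ Metric.closedBall c (t * (1 - ‖c‖)), f z = 0) := by
  obtain ⟨M, hM0, hM⟩ := hA.exists_norm_mul_sq_le
  have hM1 : 0 < 4 * (M + 1) := by positivity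
  -- On the disc `‖A‖ ≤ N = 4 M / (1 - ‖c‖)²`, since `1 - ‖z‖ ≥ (1 - ‖c‖) / 2` there. This choice
  -- gives `4 M t ≤ 1` and `t ≤ 1/4`, so `N R² = 4 M t² ≤ 1/4`.
  refine ⟨1 / (4 * (M + 1)), by positivity, ?_, fun t ht htt c hc => ?_⟩
  · exact one_div_le_one_div_of_le (by norm_num) (by linarith)
  have hc' := mem_unitDisk.1 hc
  have hd : 0 < 1 - ‖c‖ := by linarith
  have ht4 : t * (4 * (M + 1)) ≤ 1 := by rwa [le_div_iff₀ hM1] at htt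
  have htM : t * (4 * M) ≤ 1 := by nlinarith
  have htq : t ≤ 1 / 4 := by nlinarith
  have hsub := closedBall_subset_unitDisk hc (t := t) (by linarith)
  have hR : 0 < t * (1 - ‖c‖) := by positivity
  have hN : 0 ≤ 4 * M / (1 - ‖c‖) ^ 2 := by positivity
  have h2 : ∀ z ∈ Metric.closedBall c (t * (1 - ‖c‖)),
      ‖deriv (deriv f) z‖ ≤ 4 * M / (1 - ‖c‖) ^ 2 * ‖f z‖ := fun z hz => by
    rw [hf.deriv_deriv_eq (hsub hz), norm_neg, norm_mul]
    refine mul_le_mul_of_nonneg_right ?_ (norm_nonneg _)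
    rw [le_div_iff₀ (by positivity)]
    have h3 := one_sub_mul_le_of_mem_closedBall hz
    have h4 : (1 - ‖c‖) ^ 2 ≤ 4 * (1 - ‖z‖) ^ 2 := by
      have : 1 - ‖c‖ ≤ 2 * (1 - ‖z‖) := by nlinarith
      nlinarith
    nlinarith [hM z (hsub hz), mul_le_mul_of_nonneg_left h4 (norm_nonneg (A z))]
  have hNR : 4 * M / (1 - ‖c‖) ^ 2 * (t * (1 - ‖c‖)) ^ 2 ≤ 1 / 4 := by
    have : 4 * M / (1 - ‖c‖) ^ 2 * (t * (1 - ‖c‖)) ^ 2 = t * (4 * M) * t := by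
      field_simp
    rw [this]
    nlinarith
  refine ⟨norm_deriv_mul_le_of_deriv_deriv_bound isOpen_unitDisk hf.1 hR hN hsub h2 hNR,
    fun h0 h1 z hz => ?_⟩
  have := norm_sub_taylor_le_of_deriv_deriv_bound isOpen_unitDisk hf.1 hR.le hN hsub h2 hNR hz
  simpa [h0, h1] using this

theorem IsHyperbolicallySeparated.exists_mul_lt_norm_sub {Λ : Set ℂ} (hΛ : Λ ⊆ unitDisk)
    (h : IsHyperbolicallySeparated Λ) :
    ∃ δ : ℝ, 0 < δ ∧ ∀ z ∈ Λ, ∀ w ∈ Λ, z ≠ w → δ * (1 - ‖z‖) < ‖z - w‖ := by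
  obtain ⟨δ, hδ, -, h⟩ := h
  refine ⟨δ, hδ, fun z hz w hw hne => ?_⟩
  have hz' := mem_unitDisk.1 (hΛ hz)
  have hw' := mem_unitDisk.1 (hΛ hw)
  have h1 := h z hz w hw hne
  have h2 := one_sub_norm_le_norm_one_sub_conj_mul (a := w) (z := z) hw'.le
  rw [norm_one_sub_conj_mul_comm] at h2
  rw [pseudoHyperbolicDist, lt_div_iff₀ (by linarith)] at h1
  exact (mul_le_mul_of_nonneg_left h2 hδ.le).trans_lt h1

/-- At a double zero the Taylor estimate makes `f` vanish on a disc, and a nearby zero `c + s`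
violates separation. This also covers `f = 0`, whose zeros are not separated. -/
theorem IsSolution.deriv_ne_zero {A f : ℂ → ℂ} (hf : IsSolution A f) (hA : MemGrowthSpace 2 A)
    (hsep : IsHyperbolicallySeparated (diskZeros f)) {c : ℂ} (hc : c ∈ diskZeros f) :
    deriv f c ≠ 0 := by
  intro h1
  obtain ⟨δ, hδ, hsep⟩ := hsep.exists_mul_lt_norm_sub (fun z hz => hz.1)
  obtain ⟨t, ht, ht1, h⟩ := hf.exists_scale hA
  have hc' := mem_unitDisk.1 hc.1
  have h2 := (h t ht le_rfl c hc.1).2 hc.2 h1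
  set s : ℝ := min t δ * (1 - ‖c‖) with hs
  have hs0 : 0 < s := mul_pos (lt_min ht hδ) (by linarith)
  have hst : s ≤ t * (1 - ‖c‖) := mul_le_mul_of_nonneg_right (min_le_left _ _) (by linarith)
  have hsδ : s ≤ δ * (1 - ‖c‖) := mul_le_mul_of_nonneg_right (min_le_right _ _) (by linarith)
  have hmem : c + s ∈ Metric.closedBall c (t * (1 - ‖c‖)) := by
    simpa [abs_of_pos hs0] using hst
  have h3 := hsep c hc (c + s) ⟨closedBall_subset_unitDisk hc.1 (by linarith) hmem, h2 _ hmem⟩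
    (by simpa using hs0.ne')
  rw [sub_add_cancel_left, norm_neg, Complex.norm_real, Real.norm_of_nonneg hs0.le] at h3
  linarith

/-! ### Quotients, logarithms and derivatives of `f = B e^g`. -/

/-- Division of an analytic function by an analytic function with simple zeros. -/
theorem exists_differentiableOn_eq_mul {f B : ℂ → ℂ} {U : Set ℂ} (hU : IsOpen U)
    (hf : DifferentiableOn ℂ f U) (hB : DifferentiableOn ℂ B U)
    (hzero : ∀ z ∈ U, B z = 0 ↔ f z = 0) (hB' : ∀ z ∈ U, B z = 0 → deriv B z ≠ 0)
    (hf' : ∀ z ∈ U, f z = 0 → deriv f z ≠ 0) :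
    ∃ h : ℂ → ℂ, DifferentiableOn ℂ h U ∧ (∀ z ∈ U, h z ≠ 0) ∧ ∀ z ∈ U, f z = B z * h z := by
  classical
  refine ⟨fun z => if B z = 0 then deriv f z / deriv B z else f z / B z, fun z hz => ?_,
    fun z hz => ?_, fun z hz => ?_⟩
  · refine DifferentiableAt.differentiableWithinAt ?_
    have hUz := hU.mem_nhds hz
    by_cases h0 : B z = 0
    -- Near a zero the candidate is the quotient of the difference quotients of `f` and `B`, which
    -- are analytic, the one of `B` being nonzero.
    · have hfz := (hzero z hz).1 h0
      have hdf := ((Complex.differentiableOn_dslope hUz).2 hf).differentiableAt hUz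
      have hdB := ((Complex.differentiableOn_dslope hUz).2 hB).differentiableAt hUz
      have hne : dslope B z z ≠ 0 := by rw [dslope_same]; exact hB' z hz h0
      refine (hdf.fun_div hdB hne).congr_of_eventuallyEq ?_
      filter_upwards [hdB.continuousAt.eventually_ne hne] with w hw
      rcases eq_or_ne w z with rfl | hwz
      · simp [h0, dslope_same]
      · have e1 : dslope B z w = (w - z)⁻¹ * B w := by
          rw [dslope_of_ne _ hwz, slope_def_module, h0, sub_zero, smul_eq_mul]
        have e2 : dslope f z w = (w - z)⁻¹ * f w := by
          rw [dslope_of_ne _ hwz, slope_def_module, hfz, sub_zero, smul_eq_mul]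
        have hBw : B w ≠ 0 := fun h => hw (by rw [e1, h, mul_zero])
        rw [if_neg hBw, e1, e2, mul_div_mul_left _ _ (inv_ne_zero (sub_ne_zero.2 hwz))]
    · have hd := (hf.differentiableAt hUz).fun_div (hB.differentiableAt hUz) h0
      refine hd.congr_of_eventuallyEq ?_
      filter_upwards [(hB.differentiableAt hUz).continuousAt.eventually_ne h0] with w hw
      rw [if_neg hw]
  · by_cases h0 : B z = 0
    · simpa [h0] using ⟨hf' z hz ((hzero z hz).1 h0), hB' z hz h0⟩
    · simpa [h0] using fun h => h0 ((hzero z hz).2 h)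
  · by_cases h0 : B z = 0
    · simp [h0, (hzero z hz).1 h0]
    · simp only [h0, if_false]
      field_simp

/-- A primitive `g` of `h'/h` on the disc makes `h e^{-g}` constant; its value at the origin makes
the constant 1. -/
theorem exists_eq_exp_of_ne_zero {h : ℂ → ℂ} (hd : DifferentiableOn ℂ h unitDisk)
    (h0 : ∀ z ∈ unitDisk, h z ≠ 0) :
    ∃ g : ℂ → ℂ, DifferentiableOn ℂ g unitDisk ∧ ∀ z ∈ unitDisk, h z = Complex.exp (g z) := by
  have hq : DifferentiableOn ℂ (fun z => deriv h z / h z) unitDisk :=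
    (hd.deriv isOpen_unitDisk).fun_div hd h0
  obtain ⟨g, hg0, hg⟩ :=
    Complex.IsExactOn.with_val_at hq.isExactOn_ball 0 (Complex.log (h 0))
  have hg' : ∀ z ∈ unitDisk, HasDerivAt (fun z => h z * Complex.exp (-g z)) 0 z := fun z hz => by
    have e1 := (hd.differentiableAt (isOpen_unitDisk.mem_nhds hz)).hasDerivAt
    have e2 := (hg z hz).fun_neg.cexp
    convert! e1.mul e2 using 1
    have := h0 z hz
    field_simp
    ring
  have hD : (0 : ℂ) ∈ unitDisk := by simp [unitDisk]
  refine ⟨g, fun z hz => (hg z hz).differentiableAt.differentiableWithinAt, fun z hz => ?_⟩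
  have hc := isOpen_unitDisk.is_const_of_deriv_eq_zero
    (convex_ball (0 : ℂ) 1).isPreconnected
    (fun z hz => (hg' z hz).differentiableAt.differentiableWithinAt)
    (fun z hz => (hg' z hz).deriv) hz hD
  rw [hg0, Complex.exp_neg, Complex.exp_neg, Complex.exp_log (h0 0 hD), mul_inv_cancel₀ (h0 0 hD),
    mul_inv_eq_one₀ (Complex.exp_ne_zero _)] at hc
  exact hc

section Factorization

variable {f B g : ℂ → ℂ} {U : Set ℂ}

theorem deriv_eq_of_eq_mul_exp (hU : IsOpen U) (hB : DifferentiableOn ℂ B U)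
    (hg : DifferentiableOn ℂ g U) (h : ∀ z ∈ U, f z = B z * Complex.exp (g z)) {z : ℂ}
    (hz : z ∈ U) : deriv f z = (deriv B z + B z * deriv g z) * Complex.exp (g z) := by
  have hUz := hU.mem_nhds hz
  have hev : f =ᶠ[𝓝 z] fun z => B z * Complex.exp (g z) := by
    filter_upwards [hUz] with w hw using h w hw
  rw [hev.deriv_eq]
  have := (hB.differentiableAt hUz).hasDerivAt.fun_mul (hg.differentiableAt hUz).hasDerivAt.cexp
  rw [this.deriv]
  ring

theorem deriv_eq_of_deriv_deriv_eq_zero (hU : IsOpen U) (hB : DifferentiableOn ℂ B U)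
    (hg : DifferentiableOn ℂ g U) (h : ∀ z ∈ U, f z = B z * Complex.exp (g z)) {z : ℂ}
    (hz : z ∈ U) (hBz : B z = 0) (hB' : deriv B z ≠ 0) (hf : deriv (deriv f) z = 0) :
    deriv g z = -(1 / 2) * (deriv (deriv B) z / deriv B z) := by
  have hUz := hU.mem_nhds hz
  -- `f'` again has the form `B₁ e^g`, with `B₁ = B' + B g'`. Differentiating once more at a zero of
  -- `B` leaves `(B'' + 2 B' g') e^g`.
  have h1 := deriv_eq_of_eq_mul_exp hU (hB.deriv hU |>.fun_add (hB.fun_mul (hg.deriv hU))) hg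
    (fun z hz => deriv_eq_of_eq_mul_exp hU hB hg h hz) hz
  have h2 : deriv (fun z => deriv B z + B z * deriv g z) z =
      deriv (deriv B) z + (deriv B z * deriv g z + B z * deriv (deriv g) z) := by
    have e1 := ((hB.deriv hU).differentiableAt hUz).hasDerivAt
    have e2 := (hB.differentiableAt hUz).hasDerivAt
    have e3 := ((hg.deriv hU).differentiableAt hUz).hasDerivAt
    exact (e1.fun_add (e2.fun_mul e3)).deriv
  rw [hf, h2, hBz, eq_comm, mul_eq_zero, or_iff_left (Complex.exp_ne_zero _)] at h1
  field_simp
  linear_combination h1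

theorem norm_deriv_le_of_eq_mul_exp (hU : IsOpen U) (hB : DifferentiableOn ℂ B U)
    (hg : DifferentiableOn ℂ g U) (h : ∀ z ∈ U, f z = B z * Complex.exp (g z)) {z : ℂ}
    (hz : z ∈ U) (hBz : B z ≠ 0) :
    ‖deriv g z‖ ≤ ‖deriv f z‖ / ‖f z‖ + ‖deriv B z‖ / ‖B z‖ := by
  have h1 : deriv g z = deriv f z / f z - deriv B z / B z := by
    rw [deriv_eq_of_eq_mul_exp hU hB hg h hz, h z hz, mul_div_mul_right _ _ (Complex.exp_ne_zero _)]
    field_simp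
    ring
  rw [h1, ← norm_div, ← norm_div]
  exact norm_sub_le _ _

end Factorization

/-! ### The Bloch estimate and the existence of the factorization. -/

/-- A bound of order `1 / (1 - |z|)` at hyperbolic distance from a separated set extends to the
whole disc by the maximum principle. -/
theorem norm_mul_le_of_separated {G : ℂ → ℂ} (hG : DifferentiableOn ℂ G unitDisk) {Λ : Set ℂ}
    (hΛ : Λ ⊆ unitDisk) {δ t K : ℝ} (ht : 0 < t) (ht4 : t ≤ 1 / 4) (htδ : 4 * t ≤ δ)
    (hK : 0 ≤ K) (hsep : ∀ z ∈ Λ, ∀ w ∈ Λ, z ≠ w → δ * (1 - ‖z‖) < ‖z - w‖)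
    (hfar : ∀ z ∈ unitDisk, (∀ a ∈ Λ, t * (1 - ‖z‖) < ‖z - a‖) → ‖G z‖ * (1 - ‖z‖) ≤ K) {z : ℂ}
    (hz : z ∈ unitDisk) : ‖G z‖ * (1 - ‖z‖) ≤ 4 * K := by
  by_cases h : ∀ a ∈ Λ, t * (1 - ‖z‖) < ‖z - a‖
  · linarith [hfar z hz h]
  push Not at h
  obtain ⟨a, ha, hza⟩ := h
  have hz' := mem_unitDisk.1 hz
  have ha' := mem_unitDisk.1 (hΛ ha)
  have hd : 0 < 1 - ‖a‖ := by linarith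
  have h1 : 1 - ‖z‖ ≤ 2 * (1 - ‖a‖) := by
    have := norm_sub_norm_le a z
    rw [norm_sub_rev] at this
    nlinarith
  have hR : 0 < 2 * t * (1 - ‖a‖) := by positivity
  have hsub : Metric.closedBall a (2 * t * (1 - ‖a‖)) ⊆ unitDisk :=
    closedBall_subset_unitDisk (hΛ ha) (by linarith)
  -- This circle is far from `a` by its radius, and from every other `b` since `‖a - b‖` exceeds `4
  -- t (1 - ‖a‖)`, twice the radius.
  have hfr : ∀ w ∈ frontier (Metric.ball a (2 * t * (1 - ‖a‖))), ‖G w‖ ≤ 2 * K / (1 - ‖a‖) := by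
    intro w hw
    rw [frontier_ball a hR.ne'] at hw
    have hwB := Metric.sphere_subset_closedBall hw
    have hwa : ‖w - a‖ = 2 * t * (1 - ‖a‖) := by simpa [dist_eq_norm] using hw
    have h2 := one_sub_mul_le_of_mem_closedBall hwB
    have h3 : 1 - ‖w‖ ≤ (1 + 2 * t) * (1 - ‖a‖) := by
      have := norm_sub_norm_le a w
      rw [norm_sub_rev, hwa] at this
      linarith
    have h5 : t * (1 - ‖w‖) < 2 * t * (1 - ‖a‖) := by
      have : 1 - ‖w‖ < 2 * (1 - ‖a‖) := by nlinarith
      nlinarith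
    have h4 := hfar w (hsub hwB) fun b hb => by
      rcases eq_or_ne a b with rfl | hab
      · rwa [hwa]
      · have e1 := hsep a ha b hb hab
        have e2 : ‖a - b‖ ≤ ‖w - a‖ + ‖w - b‖ := by
          rw [norm_sub_rev w a]; exact norm_sub_le_norm_sub_add_norm_sub a w b
        have e3 : 4 * t * (1 - ‖a‖) ≤ δ * (1 - ‖a‖) := mul_le_mul_of_nonneg_right htδ hd.le
        linarith
    have h6 : (1 - ‖a‖) ≤ 2 * (1 - ‖w‖) := by nlinarith
    rw [le_div_iff₀ hd]
    nlinarith [mul_le_mul_of_nonneg_left h6 (norm_nonneg (G w))]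
  have hdc : DiffContOnCl ℂ G (Metric.ball a (2 * t * (1 - ‖a‖))) := by
    refine DifferentiableOn.diffContOnCl ?_
    rw [closure_ball a hR.ne']
    exact hG.mono hsub
  have hzB : z ∈ closure (Metric.ball a (2 * t * (1 - ‖a‖))) := by
    rw [closure_ball a hR.ne', Metric.mem_closedBall, dist_eq_norm]
    nlinarith
  have h7 := Complex.norm_le_of_forall_mem_frontier_norm_le Metric.isBounded_ball hdc hfr hzB
  calc ‖G z‖ * (1 - ‖z‖) ≤ 2 * K / (1 - ‖a‖) * (2 * (1 - ‖a‖)) := by gcongr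
    _ = 4 * K := by field_simp; ring

theorem IsSolution.memBloch_of_eq_mul_exp {A f B g : ℂ → ℂ} (hf : IsSolution A f)
    (hA : MemGrowthSpace 2 A) (hsep : IsUniformlySeparated (diskZeros f))
    (hB : IsBlaschkeProduct (diskZeros f) B) (hg : DifferentiableOn ℂ g unitDisk)
    (h : ∀ z ∈ unitDisk, f z = B z * Complex.exp (g z)) : MemBloch g := by
  obtain ⟨δ, hδ, hδsep⟩ := hsep.separated.exists_mul_lt_norm_sub hsep.subset_unitDisk
  obtain ⟨t₀, ht₀, ht₀4, hscale⟩ := hf.exists_scale hA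
  set t := min t₀ (δ / 4)
  have ht : 0 < t := lt_min ht₀ (by positivity)
  have htt : t ≤ t₀ := min_le_left _ _
  have htδ : t ≤ δ / 4 := min_le_right _ _
  obtain ⟨K, hK0, hK⟩ := hB.exists_norm_deriv_mul_le hsep.carleson ht
  have hfar : ∀ z ∈ unitDisk, (∀ a ∈ diskZeros f, t * (1 - ‖z‖) < ‖z - a‖) →
      ‖deriv g z‖ * (1 - ‖z‖) ≤ 4 / t + K := by
    intro z hz hza
    have hz' := mem_unitDisk.1 hz
    have hd : 0 < 1 - ‖z‖ := by linarith
    have hnz : ∀ w ∈ Metric.closedBall z (t * (1 - ‖z‖)), f w ≠ 0 := fun w hw hw0 => by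
      have := hza w ⟨closedBall_subset_unitDisk hz (by linarith) hw, hw0⟩
      rw [Metric.mem_closedBall, dist_comm, dist_eq_norm] at hw
      linarith
    have hfz : f z ≠ 0 := hnz z (Metric.mem_closedBall_self (by positivity))
    have hBz : B z ≠ 0 := fun h0 => hfz (by rw [h z hz, h0, zero_mul])
    have h1 := (hscale t ht htt z hz).1 hnz
    have h2 := hK z hz hza
    have h3 := norm_deriv_le_of_eq_mul_exp isOpen_unitDisk hB.differentiableOn hg h hz hBz
    have h4 : ‖deriv f z‖ / ‖f z‖ * (1 - ‖z‖) ≤ 4 / t := by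
      rw [div_mul_eq_mul_div, div_le_div_iff₀ (norm_pos_iff.2 hfz) ht]
      linarith
    have h5 : ‖deriv B z‖ / ‖B z‖ * (1 - ‖z‖) ≤ K := by
      rw [div_mul_eq_mul_div, div_le_iff₀ (norm_pos_iff.2 hBz)]
      refine le_trans (mul_le_mul_of_nonneg_left ?_ (norm_nonneg _)) h2
      nlinarith [norm_nonneg z]
    calc _ ≤ (‖deriv f z‖ / ‖f z‖ + ‖deriv B z‖ / ‖B z‖) * (1 - ‖z‖) := by gcongr
      _ ≤ _ := by linarith
  refine ⟨hg, 2 * (4 * (4 / t + K)), ?_⟩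
  rintro _ ⟨z, hz, rfl⟩
  have h1 := norm_mul_le_of_separated (hg.deriv isOpen_unitDisk) hsep.subset_unitDisk ht
    (by linarith) (by linarith) (by positivity) hδsep hfar hz
  have hz' := mem_unitDisk.1 hz
  have h2 : 1 - ‖z‖ ^ 2 ≤ 2 * (1 - ‖z‖) := by nlinarith [norm_nonneg z]
  calc ‖deriv g z‖ * (1 - ‖z‖ ^ 2) ≤ ‖deriv g z‖ * (2 * (1 - ‖z‖)) := by gcongr
    _ ≤ _ := by linarith

theorem IsSolution.exists_factorization {A f : ℂ → ℂ} (hf : IsSolution A f)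
    (hA : MemGrowthSpace 2 A) (hsep : IsUniformlySeparated (diskZeros f)) :
    ∃ B g : ℂ → ℂ, IsBlaschkeBlochFactorization f B g := by
  have hB : IsBlaschkeProduct (diskZeros f) fun z => ∏' a : diskZeros f, blaschkeFactor a z :=
    ⟨hsep.subset_unitDisk, hsep.summable,
      hasProdLocallyUniformlyOn_blaschkeFactor hsep.subset_unitDisk hsep.summable⟩
  set B : ℂ → ℂ := fun z => ∏' a : diskZeros f, blaschkeFactor a z
  have hzero : ∀ z ∈ unitDisk, B z = 0 ↔ f z = 0 := fun z hz => by
    rw [hB.eq_zero_iff hz]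
    exact ⟨fun h => h.2, fun h => ⟨hz, h⟩⟩
  have hB' : ∀ z ∈ unitDisk, B z = 0 → deriv B z ≠ 0 := fun z hz h =>
    hB.deriv_ne_zero ((hB.eq_zero_iff hz).1 h)
  obtain ⟨h, hd, h0, hfh⟩ := exists_differentiableOn_eq_mul isOpen_unitDisk hf.1
    hB.differentiableOn hzero hB' fun z hz h => hf.deriv_ne_zero hA hsep.separated ⟨hz, h⟩
  obtain ⟨g, hg, hgh⟩ := exists_eq_exp_of_ne_zero hd h0
  have hfg : ∀ z ∈ unitDisk, f z = B z * Complex.exp (g z) := fun z hz => by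
    rw [hfh z hz, hgh z hz]
  refine ⟨B, g, hB, hf.memBloch_of_eq_mul_exp hA hsep hB hg hfg, fun z hz => ?_, hfg⟩
  have hBz := (hB.eq_zero_iff hz.1).2 hz
  refine ⟨hB' z hz.1 hBz, deriv_eq_of_deriv_deriv_eq_zero isOpen_unitDisk hB.differentiableOn hg
    hfg hz.1 hBz (hB' z hz.1 hBz) ?_⟩
  rw [hf.deriv_deriv_eq hz.1, hz.2, mul_zero, neg_zero]

/-! ### Parseval's identity on circles. -/

theorem integral_exp_int_mul_I (k : ℤ) :
    ∫ θ in (0 : ℝ)..(2 * Real.pi), Complex.exp (k * θ * Complex.I) =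
      if k = 0 then (2 * Real.pi : ℂ) else 0 := by
  split_ifs with hk
  · simp [hk]
  · have hk' : (k * Complex.I : ℂ) ≠ 0 :=
      mul_ne_zero (Int.cast_ne_zero.2 hk) Complex.I_ne_zero
    have h := integral_exp_mul_complex (a := 0) (b := 2 * Real.pi) hk'
    have e : ∀ θ : ℝ, (k * θ * Complex.I : ℂ) = k * Complex.I * θ := fun θ => by ring
    simp_rw [e, h]
    have e2 : (k * Complex.I * ((2 * Real.pi : ℝ) : ℂ) : ℂ) = k * (2 * Real.pi * Complex.I) := by
      push_cast; ring
    rw [e2, Complex.exp_int_mul_two_pi_mul_I]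
    simp

section Parseval

variable {c : ℕ → ℂ} {G : ℝ → ℂ}

theorem norm_exp_natCast_mul_ofReal_mul_I (n : ℕ) (θ : ℝ) :
    ‖Complex.exp (n * θ * Complex.I)‖ = 1 := by
  have := Complex.norm_exp_ofReal_mul_I (n * θ)
  push_cast at this
  exact this

theorem hasSum_integral_mul_of_summable (hc : Summable fun n => ‖c n‖) {u : ℕ → ℝ → ℂ}
    (hu : ∀ n, Continuous (u n)) (hle : ∀ n θ, ‖u n θ‖ ≤ ‖c n‖)
    (hG : ∀ θ, HasSum (fun n => u n θ) (G θ)) {w : ℝ → ℂ} (hw : Continuous w) {M : ℝ}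
    (hM : ∀ θ, ‖w θ‖ ≤ M) :
    HasSum (fun n => ∫ θ in (0 : ℝ)..(2 * Real.pi), u n θ * w θ)
      (∫ θ in (0 : ℝ)..(2 * Real.pi), G θ * w θ) := by
  refine intervalIntegral.hasSum_integral_of_dominated_convergence
    (fun n _ => ‖c n‖ * M) (fun n => ((hu n).mul hw).aestronglyMeasurable)
    (fun n => ae_of_all _ fun θ _ => ?_) (ae_of_all _ fun _ _ => hc.mul_right M)
    intervalIntegrable_const (ae_of_all _ fun θ _ => (hG θ).mul_right _)
  rw [norm_mul]
  exact mul_le_mul (hle n θ) (hM θ) (norm_nonneg _) (norm_nonneg _)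

/-- Parseval's identity for absolutely convergent trigonometric series with nonnegative
frequencies. -/
theorem hasSum_norm_sq_of_hasSum_exp (hc : Summable fun n => ‖c n‖)
    (hG : ∀ θ : ℝ, HasSum (fun n : ℕ => c n * Complex.exp (n * θ * Complex.I)) (G θ)) :
    HasSum (fun n => ‖c n‖ ^ 2)
      (1 / (2 * Real.pi) * ∫ θ in (0 : ℝ)..(2 * Real.pi), ‖G θ‖ ^ 2) := by
  have hcont : ∀ n : ℕ, Continuous fun θ : ℝ => Complex.exp (n * θ * Complex.I) := fun n => by
    fun_prop
  have hle : ∀ (n : ℕ) (θ : ℝ), ‖c n * Complex.exp (n * θ * Complex.I)‖ ≤ ‖c n‖ := fun n θ => by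
    rw [norm_mul, norm_exp_natCast_mul_ofReal_mul_I, mul_one]
  have hGc : Continuous G := by
    have : G = fun θ : ℝ => ∑' n : ℕ, c n * Complex.exp (n * θ * Complex.I) :=
      funext fun θ => (hG θ).tsum_eq.symm
    rw [this]
    exact continuous_tsum (fun n => continuous_const.mul (hcont n)) hc hle
  have hGle : ∀ θ, ‖G θ‖ ≤ ∑' n, ‖c n‖ := fun θ => by
    rw [← (hG θ).tsum_eq]
    exact tsum_of_norm_bounded hc.hasSum (hle · θ)
  -- Computing Fourier coefficients first means that only one factor of `G * conj G` is expanded at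
  -- a time, so no double series arises.
  have hcoeff : ∀ n : ℕ, ∫ θ in (0 : ℝ)..(2 * Real.pi),
      Complex.exp (n * θ * Complex.I) * conj (G θ) = 2 * Real.pi * conj (c n) := by
    intro n
    have h1 : HasSum (fun m : ℕ => ∫ θ in (0 : ℝ)..(2 * Real.pi),
        conj (c m * Complex.exp (m * θ * Complex.I)) * Complex.exp (n * θ * Complex.I))
        (∫ θ in (0 : ℝ)..(2 * Real.pi), conj (G θ) * Complex.exp (n * θ * Complex.I)) := by
      refine hasSum_integral_mul_of_summable hc (fun m => ?_) (fun m θ => ?_) (fun θ => ?_)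
        (hcont n) (M := 1) fun θ => (norm_exp_natCast_mul_ofReal_mul_I n θ).le
      · exact Complex.continuous_conj.comp (continuous_const.mul (hcont m))
      · rw [RCLike.norm_conj]; exact hle m θ
      · exact Complex.hasSum_conj'.2 (by simpa using hG θ)
    have h2 : ∀ m : ℕ, ∫ θ in (0 : ℝ)..(2 * Real.pi),
        conj (c m * Complex.exp (m * θ * Complex.I)) * Complex.exp (n * θ * Complex.I) =
        if m = n then 2 * Real.pi * conj (c n) else 0 := by
      intro m
      have e : ∀ θ : ℝ,
          conj (c m * Complex.exp (m * θ * Complex.I)) * Complex.exp (n * θ * Complex.I) =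
          conj (c m) * Complex.exp (((n - m : ℤ) : ℂ) * θ * Complex.I) := fun θ => by
        rw [map_mul, ← Complex.exp_conj, mul_assoc, ← Complex.exp_add]
        simp only [map_mul, Complex.conj_I, Complex.conj_ofReal, Complex.conj_natCast]
        push_cast
        ring_nf
      simp_rw [e]
      rw [intervalIntegral.integral_const_mul, integral_exp_int_mul_I]
      rcases eq_or_ne m n with rfl | hmn
      · simp [mul_comm]
      · have : (n - m : ℤ) ≠ 0 := by omega
        simp [this, hmn]
    simp_rw [h2] at h1
    have h3 := h1.unique (hasSum_ite_eq n (2 * Real.pi * conj (c n)))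
    rw [← h3]
    exact intervalIntegral.integral_congr fun θ _ => mul_comm _ _
  have h4 := hasSum_integral_mul_of_summable
    (u := fun n θ => c n * Complex.exp (n * θ * Complex.I)) (w := fun θ => conj (G θ)) hc
    (fun n => continuous_const.mul (hcont n)) hle hG (Complex.continuous_conj.comp hGc)
    (fun θ => by rw [RCLike.norm_conj]; exact hGle θ)
  have h5 : ∀ n : ℕ, ∫ θ in (0 : ℝ)..(2 * Real.pi),
      c n * Complex.exp (n * θ * Complex.I) * conj (G θ) =
      ((2 * Real.pi * ‖c n‖ ^ 2 : ℝ) : ℂ) := fun n => by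
    simp_rw [mul_assoc (c n)]
    rw [intervalIntegral.integral_const_mul, hcoeff, mul_left_comm, Complex.mul_conj']
    push_cast
    ring
  have h6 : ∫ θ in (0 : ℝ)..(2 * Real.pi), G θ * conj (G θ) =
      ((∫ θ in (0 : ℝ)..(2 * Real.pi), ‖G θ‖ ^ 2 : ℝ) : ℂ) := by
    rw [← intervalIntegral.integral_ofReal]
    refine intervalIntegral.integral_congr fun θ _ => ?_
    simp only [Complex.mul_conj']
    push_cast
    rfl
  simp_rw [h5, h6] at h4
  have h7 := (Complex.hasSum_ofReal.1 h4).mul_left (1 / (2 * Real.pi))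
  have hpi := Real.pi_pos
  convert! h7 using 2 with n
  field_simp

end Parseval

open Nat in
/-- The Taylor coefficients at the origin. -/
noncomputable def taylorCoeff (F : ℂ → ℂ) (n : ℕ) : ℂ := (n ! : ℂ)⁻¹ * iteratedDeriv n F 0

theorem hasSum_taylorCoeff {F : ℂ → ℂ} (hF : DifferentiableOn ℂ F unitDisk) {z : ℂ}
    (hz : z ∈ unitDisk) : HasSum (fun n => taylorCoeff F n * z ^ n) (F z) := by
  have := Complex.hasSum_taylorSeries_on_ball hF hz
  simp only [sub_zero, smul_eq_mul] at this
  convert! this using 2 with n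
  rw [taylorCoeff]
  ring

theorem taylorCoeff_deriv (F : ℂ → ℂ) (n : ℕ) :
    taylorCoeff (deriv F) n = (n + 1) * taylorCoeff F (n + 1) := by
  have h : (n + 1 : ℂ) ≠ 0 := by exact_mod_cast n.succ_ne_zero
  rw [taylorCoeff, taylorCoeff, iteratedDeriv_succ', Nat.factorial_succ]
  push_cast
  field_simp

/-- Parseval's identity for an analytic function on a circle. -/
theorem hasSum_norm_taylorCoeff_sq {F : ℂ → ℂ} (hF : DifferentiableOn ℂ F unitDisk) {r : ℝ}
    (hr0 : 0 ≤ r) (hr1 : r < 1) :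
    HasSum (fun n => ‖taylorCoeff F n‖ ^ 2 * (r ^ 2) ^ n)
      (1 / (2 * Real.pi) *
        ∫ θ in (0 : ℝ)..(2 * Real.pi), ‖F (r * Complex.exp (θ * Complex.I))‖ ^ 2) := by
  have hmem : ∀ θ : ℝ, (r * Complex.exp (θ * Complex.I) : ℂ) ∈ unitDisk := fun θ => by
    rw [mem_unitDisk, norm_mul, Complex.norm_exp_ofReal_mul_I, Complex.norm_real,
      Real.norm_of_nonneg hr0, mul_one]
    exact hr1
  have hc : Summable fun n => ‖taylorCoeff F n * (r : ℂ) ^ n‖ := by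
    have := (hasSum_taylorCoeff hF (z := r) (by simpa using hmem 0)).summable
    exact this.norm
  have h := hasSum_norm_sq_of_hasSum_exp hc
    (G := fun θ : ℝ => F (r * Complex.exp (θ * Complex.I))) fun θ => by
      convert! hasSum_taylorCoeff hF (hmem θ) using 2 with n
      rw [mul_pow, ← Complex.exp_nat_mul, mul_assoc, mul_assoc]
  convert! h using 2 with n
  rw [norm_mul, norm_pow, Complex.norm_real, Real.norm_of_nonneg hr0]
  ring

/-! ### A differential inequality for power series with nonnegative coefficients. -/

section PowerSeries

/-- The convex function `y ^ (n + 1)` lies above its tangent at `x`. This dominates the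
differentiated series at `x` by the original one at `s > x`. -/
theorem nat_mul_pow_mul_sub_add_pow_le {x s : ℝ} (hx : 0 ≤ x) (hxs : x ≤ s) (n : ℕ) :
    (n + 1) * x ^ n * (s - x) + x ^ (n + 1) ≤ s ^ (n + 1) := by
  induction n with
  | zero => simp
  | succ n ih =>
    have h1 := mul_le_mul_of_nonneg_left ih (hx.trans hxs)
    have h2 : 0 ≤ (n + 1) * x ^ n * (s - x) * (s - x) := by
      have := sub_nonneg.2 hxs
      positivity
    push_cast
    calc _ = s * ((n + 1) * x ^ n * (s - x) + x ^ (n + 1)) -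
          (n + 1) * x ^ n * (s - x) * (s - x) := by ring
      _ ≤ s * s ^ (n + 1) := by linarith
      _ = _ := by ring

variable {c : ℕ → ℝ}

theorem summable_succ_mul_pow (hc : ∀ n, 0 ≤ c n)
    (hs : ∀ x ∈ Ico (0 : ℝ) 1, Summable fun n => c n * x ^ n) {x : ℝ} (hx : x ∈ Ico (0 : ℝ) 1) :
    Summable fun n : ℕ => (n + 1) * c (n + 1) * x ^ n := by
  obtain ⟨s, hxs, hs1⟩ := exists_between hx.2
  have hsx : 0 < s - x := sub_pos.2 hxs
  have h1 : Summable fun n => c (n + 1) * s ^ (n + 1) * (s - x)⁻¹ :=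
    ((summable_nat_add_iff 1).2 (hs s ⟨hx.1.trans hxs.le, hs1⟩)).mul_right _
  refine h1.of_nonneg_of_le (fun n => ?_) fun n => ?_
  · have := hc (n + 1)
    have := hx.1
    positivity
  · rw [← div_eq_mul_inv, le_div_iff₀ hsx]
    have h2 := nat_mul_pow_mul_sub_add_pow_le hx.1 hxs.le n
    have h3 : 0 ≤ x ^ (n + 1) := pow_nonneg hx.1 _
    calc (n + 1) * c (n + 1) * x ^ n * (s - x) = c (n + 1) * ((n + 1) * x ^ n * (s - x)) := by ring
      _ ≤ _ := mul_le_mul_of_nonneg_left (by linarith) (hc _)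

theorem hasDerivAt_tsum_mul_pow (hc : ∀ n, 0 ≤ c n)
    (hs : ∀ x ∈ Ico (0 : ℝ) 1, Summable fun n => c n * x ^ n) {x : ℝ} (hx : x ∈ Ico (0 : ℝ) 1) :
    HasDerivAt (fun y => ∑' n, c n * y ^ n) (∑' n : ℕ, (n + 1) * c (n + 1) * x ^ n) x := by
  obtain ⟨s, hxs, hs1⟩ := exists_between hx.2
  have hs0 : 0 < s := hx.1.trans_lt hxs
  have hu := summable_succ_mul_pow hc hs ⟨hs0.le, hs1⟩
  have hu' : Summable fun n : ℕ => n * c n * s ^ (n - 1) := by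
    rw [← summable_nat_add_iff 1]
    simpa using hu
  have h := hasDerivAt_tsum_of_isPreconnected (g := fun n y => c n * y ^ n)
    (g' := fun n y => n * c n * y ^ (n - 1)) (t := Ioo (-s) s) (y₀ := 0) (y := x) hu' isOpen_Ioo
    isPreconnected_Ioo (fun n y _ => ?_) (fun n y hy => ?_) ⟨by linarith, hs0⟩
    (hs 0 ⟨le_rfl, one_pos⟩) ⟨by linarith [hx.1], hxs⟩
  · convert! h using 1
    rw [Summable.tsum_eq_zero_add (f := fun n : ℕ => n * c n * x ^ (n - 1))]
    · simp
    · rw [← summable_nat_add_iff 1]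
      simpa using summable_succ_mul_pow hc hs hx
  · convert! (hasDerivAt_pow n y).const_mul (c n) using 1
    ring
  · have hn := hc n
    rw [norm_mul, norm_pow, Real.norm_of_nonneg (by positivity)]
    have : ‖y‖ ≤ s := abs_le.2 ⟨hy.1.le, hy.2.le⟩
    gcongr

/-- A power series `φ` with nonnegative coefficients and
`(x φ'(x))' ≤ k φ(x) / (1 - x) ^ 2` grows at most like `(1 - x) ^ (-k)`. -/
theorem tsum_mul_pow_mul_rpow_le {k : ℝ} (hc : ∀ n, 0 ≤ c n)
    (hs : ∀ x ∈ Ico (0 : ℝ) 1, Summable fun n => c n * x ^ n)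
    (hle : ∀ x ∈ Ico (0 : ℝ) 1, ∑' n : ℕ, (n + 1) ^ 2 * c (n + 1) * x ^ n ≤
      k / (1 - x) ^ 2 * ∑' n, c n * x ^ n) (hk : 0 ≤ k) {x : ℝ} (hx : x ∈ Ico (0 : ℝ) 1) :
    (∑' n, c n * x ^ n) * (1 - x) ^ k ≤ c 0 := by
  set φ : ℝ → ℝ := fun x => ∑' n, c n * x ^ n with hφ
  set φ' : ℝ → ℝ := fun x => ∑' n : ℕ, (n + 1) * c (n + 1) * x ^ n with hφ'
  have hd : ∀ x ∈ Ico (0 : ℝ) 1, HasDerivAt φ (φ' x) x := fun x hx =>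
    hasDerivAt_tsum_mul_pow hc hs hx
  have hφ'0 : ∀ x ∈ Ico (0 : ℝ) 1, 0 ≤ φ' x := fun x hx => tsum_nonneg fun n => by
    have := hc (n + 1)
    have := hx.1
    positivity
  have hsub : ∀ {y : ℝ}, y ∈ Ico (0 : ℝ) 1 → Icc 0 y ⊆ Ico (0 : ℝ) 1 := fun hy z hz =>
    ⟨hz.1, hz.2.trans_lt hy.2⟩
  have hmono : ∀ y ∈ Ico (0 : ℝ) 1, MonotoneOn φ (Icc 0 y) := fun y hy => by
    refine monotoneOn_of_deriv_nonneg (convex_Icc 0 y)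
      (fun z hz => (hd z (hsub hy hz)).continuousAt.continuousWithinAt)
      (fun z hz => (hd z (hsub hy (interior_subset hz))).differentiableAt.differentiableWithinAt)
      fun z hz => ?_
    rw [(hd z (hsub hy (interior_subset hz))).deriv]
    exact hφ'0 z (hsub hy (interior_subset hz))
  -- This series is `x φ'(x)`; its derivative carries the factor `(n + 1) ^ 2` of `hle`.
  have hψs : ∀ x ∈ Ico (0 : ℝ) 1, Summable fun n : ℕ => (n * c n) * x ^ n := fun x hx => by
    rw [← summable_nat_add_iff 1]
    convert! (summable_succ_mul_pow hc hs hx).mul_right x using 2 with n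
    push_cast
    ring
  have hψ : ∀ x ∈ Ico (0 : ℝ) 1, ∑' n : ℕ, (n * c n) * x ^ n = x * φ' x := fun x hx => by
    rw [(hψs x hx).tsum_eq_zero_add, hφ', ← tsum_mul_left]
    simp only [Nat.cast_zero, zero_mul, zero_add]
    refine tsum_congr fun n => ?_
    push_cast
    ring
  have hψd : ∀ x ∈ Ico (0 : ℝ) 1, HasDerivAt (fun y => ∑' n : ℕ, (n * c n) * y ^ n)
      (∑' n : ℕ, (n + 1) ^ 2 * c (n + 1) * x ^ n) x := fun x hx => by
    convert! hasDerivAt_tsum_mul_pow (c := fun n => n * c n)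
      (fun n => mul_nonneg n.cast_nonneg (hc n)) hψs hx using 1
    refine tsum_congr fun n => ?_
    push_cast
    ring
  -- Integrating `hle` over `[0, y]` with `φ z ≤ φ y` gives `y φ'(y) ≤ k φ(y) (1 / (1 - y) - 1)`,
  -- and `y` cancels. The result says that `φ(y) (1 - y)^k` decreases.
  have hfirst : ∀ y ∈ Ioo (0 : ℝ) 1, φ' y * (1 - y) ≤ k * φ y := fun y hy => by
    have hy' : y ∈ Ico (0 : ℝ) 1 := Ioo_subset_Ico_self hy
    have hder : ∀ z ∈ Icc 0 y, HasDerivAt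
        (fun z => k * φ y * (1 - z)⁻¹ - ∑' n : ℕ, (n * c n) * z ^ n)
        (k * φ y * (1 / (1 - z) ^ 2) - ∑' n : ℕ, (n + 1) ^ 2 * c (n + 1) * z ^ n) z :=
      fun z hz => by
        have hz' := hsub hy' hz
        have h1 := ((hasDerivAt_id' z).const_sub 1).fun_inv (sub_pos.2 hz'.2).ne'
        convert! (h1.const_mul (k * φ y)).fun_sub (hψd z hz') using 1
        ring
    have hm : MonotoneOn (fun z => k * φ y * (1 - z)⁻¹ - ∑' n : ℕ, (n * c n) * z ^ n)
        (Icc 0 y) := by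
      refine monotoneOn_of_deriv_nonneg (convex_Icc 0 y)
        (fun z hz => (hder z hz).continuousAt.continuousWithinAt)
        (fun z hz => (hder z (interior_subset hz)).differentiableAt.differentiableWithinAt)
        fun z hz => ?_
      have hz1 := interior_subset hz
      have hz' := hsub hy' hz1
      have h1 : φ z ≤ φ y := hmono y hy' hz1 ⟨hy'.1, le_rfl⟩ hz1.2
      have h2 : 0 < 1 - z := sub_pos.2 hz'.2
      have h3 : k / (1 - z) ^ 2 * φ z ≤ k / (1 - z) ^ 2 * φ y :=
        mul_le_mul_of_nonneg_left h1 (by positivity)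
      rw [(hder z hz1).deriv]
      have h4 := hle z hz'
      have e : k * φ y * (1 / (1 - z) ^ 2) = k / (1 - z) ^ 2 * φ y := by ring
      linarith
    have h5 := hm ⟨le_rfl, hy'.1⟩ ⟨hy'.1, le_rfl⟩ hy'.1
    simp only at h5
    have h1y : 0 < 1 - y := sub_pos.2 hy.2
    rw [hψ y hy', hψ 0 ⟨le_rfl, one_pos⟩] at h5
    have e : k * φ y * (1 - y)⁻¹ - k * φ y = k * φ y * y / (1 - y) := by
      field_simp
      ring
    have h6 : y * φ' y ≤ k * φ y * y / (1 - y) := by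
      rw [← e]
      simp only [sub_zero, inv_one, mul_one, zero_mul] at h5
      linarith
    rw [le_div_iff₀ h1y] at h6
    refine le_of_mul_le_mul_left ?_ hy.1
    linarith
  have hanti : AntitoneOn (fun y => φ y * (1 - y) ^ k) (Icc 0 x) := by
    have hder : ∀ y ∈ Icc 0 x, HasDerivAt (fun y => φ y * (1 - y) ^ k)
        (φ' y * (1 - y) ^ k + φ y * (-1 * k * (1 - y) ^ (k - 1))) y := fun y hy => by
      have hy' := hsub hx hy
      exact (hd y hy').fun_mul (((hasDerivAt_id' y).const_sub 1).rpow_const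
        (Or.inl (sub_pos.2 hy'.2).ne'))
    refine antitoneOn_of_deriv_nonpos (convex_Icc 0 x)
      (fun y hy => (hder y hy).continuousAt.continuousWithinAt)
      (fun y hy => (hder y (interior_subset hy)).differentiableAt.differentiableWithinAt)
      fun y hy => ?_
    have hy' : y ∈ Ioo (0 : ℝ) 1 := by
      rw [interior_Icc] at hy
      exact ⟨hy.1, hy.2.trans hx.2⟩
    have h1y : 0 < 1 - y := sub_pos.2 hy'.2
    rw [(hder y (interior_subset hy)).deriv]
    have e : (1 - y) ^ k = (1 - y) ^ (k - 1) * (1 - y) := by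
      rw [Real.rpow_sub_one h1y.ne']; field_simp
    rw [e]
    have h2 : 0 ≤ (1 - y) ^ (k - 1) := Real.rpow_nonneg h1y.le _
    nlinarith [mul_le_mul_of_nonneg_left (hfirst y hy') h2]
  have h0 := hanti ⟨le_rfl, hx.1⟩ ⟨hx.1, le_rfl⟩ hx.1
  have hφ0 : φ 0 = c 0 := by
    rw [hφ]
    simp only
    rw [tsum_eq_single 0 fun n hn => by simp [hn]]
    simp
  simpa [hφ0] using h0

end PowerSeries

/-! ### Growth of the integral means. -/

theorem MemBloch.norm_deriv_mul_le {g : ℂ → ℂ} (hg : MemBloch g) {z : ℂ} (hz : z ∈ unitDisk) :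
    ‖deriv g z‖ * (1 - ‖z‖ ^ 2) ≤ blochNorm g :=
  le_csSup hg.2 (mem_image_of_mem _ hz)

theorem continuous_comp_circle {F : ℂ → ℂ} (hF : DifferentiableOn ℂ F unitDisk) {r : ℝ}
    (hr0 : 0 ≤ r) (hr1 : r < 1) :
    Continuous fun θ : ℝ => F (r * Complex.exp (θ * Complex.I)) := by
  refine hF.continuousOn.comp_continuous (by fun_prop) fun θ => ?_
  rw [mem_unitDisk, norm_mul, Complex.norm_exp_ofReal_mul_I, Complex.norm_real,
    Real.norm_of_nonneg hr0, mul_one]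
  exact hr1

/-- Growth of the quadratic means of `F` when `|F'| ≤ b |F| / (1 - |z|²)`. -/
theorem integral_norm_sq_mul_rpow_le {F : ℂ → ℂ} (hF : DifferentiableOn ℂ F unitDisk) {b : ℝ}
    (hle : ∀ z ∈ unitDisk, ‖deriv F z‖ * (1 - ‖z‖ ^ 2) ≤ b * ‖F z‖) {r : ℝ}
    (hr0 : 0 ≤ r) (hr1 : r < 1) :
    (1 / (2 * Real.pi) *
        ∫ θ in (0 : ℝ)..(2 * Real.pi), ‖F (r * Complex.exp (θ * Complex.I))‖ ^ 2) *
      (1 - r ^ 2) ^ (b ^ 2) ≤ ‖F 0‖ ^ 2 := by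
  have hpi := Real.pi_pos
  have hsqrt : ∀ x ∈ Ico (0 : ℝ) 1, 0 ≤ √x ∧ √x < 1 ∧ √x ^ 2 = x := fun x hx =>
    ⟨Real.sqrt_nonneg x, by rw [Real.sqrt_lt' one_pos]; simpa using hx.2, Real.sq_sqrt hx.1⟩
  have h := tsum_mul_pow_mul_rpow_le (c := fun n => ‖taylorCoeff F n‖ ^ 2) (k := b ^ 2)
    (fun n => by positivity) (fun x hx => ?_) (fun x hx => ?_) (sq_nonneg b)
    (x := r ^ 2) ⟨sq_nonneg r, by nlinarith⟩
  · rw [(hasSum_norm_taylorCoeff_sq hF hr0 hr1).tsum_eq] at h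
    simpa [taylorCoeff] using h
  · obtain ⟨h0, h1, h2⟩ := hsqrt x hx
    have := (hasSum_norm_taylorCoeff_sq hF h0 h1).summable
    rwa [h2] at this
  · obtain ⟨h0, h1, h2⟩ := hsqrt x hx
    have hF' : DifferentiableOn ℂ (deriv F) unitDisk := hF.deriv isOpen_unitDisk
    have e1 := hasSum_norm_taylorCoeff_sq hF h0 h1
    have e2 := hasSum_norm_taylorCoeff_sq hF' h0 h1
    rw [h2] at e1 e2
    -- Parseval for `F'` is the left side of the differential inequality, so a pointwise comparison
    -- of `F'` with `F` on the circle of radius `√x` suffices.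
    have e3 : ∀ n : ℕ, ‖taylorCoeff (deriv F) n‖ ^ 2 * x ^ n =
        (n + 1) ^ 2 * ‖taylorCoeff F (n + 1)‖ ^ 2 * x ^ n := fun n => by
      have : ‖(n + 1 : ℂ)‖ = n + 1 := by exact_mod_cast Complex.norm_natCast (n + 1)
      rw [taylorCoeff_deriv, norm_mul, this, mul_pow]
    simp_rw [e3] at e2
    rw [e1.tsum_eq, e2.tsum_eq, mul_left_comm]
    refine mul_le_mul_of_nonneg_left ?_ (by positivity)
    rw [← intervalIntegral.integral_const_mul]
    refine intervalIntegral.integral_mono_on (by positivity)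
      (Continuous.intervalIntegrable ((continuous_comp_circle hF' h0 h1).norm.pow 2) _ _)
      (Continuous.intervalIntegrable
        (((continuous_comp_circle hF h0 h1).norm.pow 2).const_mul _) _ _) fun θ _ => ?_
    have hn : ‖(√x * Complex.exp (θ * Complex.I) : ℂ)‖ = √x := by
      rw [norm_mul, Complex.norm_exp_ofReal_mul_I, Complex.norm_real, Real.norm_of_nonneg h0,
        mul_one]
    have h3 := hle (√x * Complex.exp (θ * Complex.I)) (by rw [mem_unitDisk, hn]; exact h1)
    have hx1 : 0 < 1 - x := sub_pos.2 hx.2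
    rw [hn, h2] at h3
    have h4 := pow_le_pow_left₀ (mul_nonneg (norm_nonneg _) hx1.le) h3 2
    rw [div_mul_eq_mul_div, le_div_iff₀ (by positivity)]
    simpa only [mul_pow] using h4

theorem IsBlaschkeBlochFactorization.integralMean_mul_rpow_le {f B g : ℂ → ℂ}
    (hf : DifferentiableOn ℂ f unitDisk) (h : IsBlaschkeBlochFactorization f B g) {p r : ℝ}
    (hp : 0 < p) (hr : r ∈ Ioo (0 : ℝ) 1) :
    integralMean p r f * (1 - r) ^ (p * blochNorm g ^ 2) ≤
      (‖Complex.exp (p / 2 * g 0)‖ ^ 2) ^ (1 / p) := by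
  have hpi := Real.pi_pos
  set β := blochNorm g
  set F : ℂ → ℂ := fun z => Complex.exp (p / 2 * g z) with hFdef
  have hg := h.bloch.1
  have hF : DifferentiableOn ℂ F unitDisk := (hg.const_mul _).cexp
  have hle : ∀ z ∈ unitDisk, ‖deriv F z‖ * (1 - ‖z‖ ^ 2) ≤ (p / 2 * β) * ‖F z‖ := fun z hz => by
    have hd := ((hg.differentiableAt (isOpen_unitDisk.mem_nhds hz)).hasDerivAt.const_mul
      (p / 2 : ℂ)).cexp
    have hp2 : ‖(p / 2 : ℂ)‖ = p / 2 := by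
      rw [norm_div, Complex.norm_real, Real.norm_of_nonneg hp.le]; simp
    rw [hd.deriv, norm_mul, norm_mul, hp2]
    calc ‖F z‖ * (p / 2 * ‖deriv g z‖) * (1 - ‖z‖ ^ 2)
        = p / 2 * (‖deriv g z‖ * (1 - ‖z‖ ^ 2)) * ‖F z‖ := by ring
      _ ≤ p / 2 * β * ‖F z‖ := by gcongr; exact h.bloch.norm_deriv_mul_le hz
  have h1 := integral_norm_sq_mul_rpow_le hF hle hr.1.le hr.2
  have hmem : ∀ θ : ℝ, (r * Complex.exp (θ * Complex.I) : ℂ) ∈ unitDisk := fun θ => by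
    rw [mem_unitDisk, norm_mul, Complex.norm_exp_ofReal_mul_I, Complex.norm_real,
      Real.norm_of_nonneg hr.1.le, mul_one]
    exact hr.2
  have hfF : ∀ z ∈ unitDisk, ‖f z‖ ^ p ≤ ‖F z‖ ^ 2 := fun z hz => by
    have e1 : ‖f z‖ ≤ Real.exp (g z).re := by
      rw [h.eq_mul_exp z hz, norm_mul, Complex.norm_exp]
      exact mul_le_of_le_one_left (Real.exp_pos _).le (h.blaschke.norm_le_one hz)
    have e2 : (p / 2 * g z : ℂ).re = p / 2 * (g z).re := by
      have : (p / 2 * g z : ℂ) = ((p / 2 : ℝ) : ℂ) * g z := by push_cast; rfl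
      rw [this, Complex.re_ofReal_mul]
    calc ‖f z‖ ^ p ≤ Real.exp (g z).re ^ p := Real.rpow_le_rpow (norm_nonneg _) e1 hp.le
      _ = ‖F z‖ ^ 2 := by
        rw [← Real.exp_mul, hFdef, Complex.norm_exp, e2, ← Real.exp_nat_mul]
        congr 1
        push_cast
        ring
  set I := 1 / (2 * Real.pi) *
    ∫ θ in (0 : ℝ)..(2 * Real.pi), ‖f (r * Complex.exp (θ * Complex.I))‖ ^ p
  have hI0 : 0 ≤ I := mul_nonneg (by positivity) (intervalIntegral.integral_nonneg (by positivity)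
    fun θ _ => Real.rpow_nonneg (norm_nonneg _) _)
  have h2 : I ≤ 1 / (2 * Real.pi) *
      ∫ θ in (0 : ℝ)..(2 * Real.pi), ‖F (r * Complex.exp (θ * Complex.I))‖ ^ 2 := by
    refine mul_le_mul_of_nonneg_left ?_ (by positivity)
    exact intervalIntegral.integral_mono_on (by positivity)
      (Continuous.intervalIntegrable
        ((continuous_comp_circle hf hr.1.le hr.2).norm.rpow_const fun _ => Or.inr hp.le) _ _)
      (Continuous.intervalIntegrable ((continuous_comp_circle hF hr.1.le hr.2).norm.pow 2) _ _)
      fun θ _ => hfF _ (hmem θ)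
  have hr1 : 0 < 1 - r := sub_pos.2 hr.2
  have hr2 : 1 - r ≤ 1 - r ^ 2 := by nlinarith [hr.1]
  have h3 : I * (1 - r) ^ (p * (p * β ^ 2)) ≤ ‖F 0‖ ^ 2 := by
    refine le_trans ?_ h1
    refine mul_le_mul h2 ?_ (Real.rpow_nonneg hr1.le _) (hI0.trans h2)
    -- The argument yields the exponent `p² β² / 4`; the claim needs only `p² β²`, which becomes `p
    -- β²` after the root of order `p`.
    calc (1 - r) ^ (p * (p * β ^ 2)) ≤ (1 - r) ^ ((p / 2 * β) ^ 2) := by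
          refine Real.rpow_le_rpow_of_exponent_ge hr1 (by linarith [hr.1]) ?_
          nlinarith [sq_nonneg (p * β)]
      _ ≤ _ := Real.rpow_le_rpow hr1.le hr2 (sq_nonneg _)
  have h4 := Real.rpow_le_rpow (mul_nonneg hI0 (Real.rpow_nonneg hr1.le _)) h3
    (one_div_nonneg.2 hp.le)
  rw [Real.mul_rpow hI0 (Real.rpow_nonneg hr1.le _), ← Real.rpow_mul hr1.le] at h4
  have e : p * (p * β ^ 2) * (1 / p) = p * β ^ 2 := by field_simp
  rw [e] at h4
  exact h4

theorem corollary2 (A f : ℂ → ℂ) (hA : MemGrowthSpace 2 A) (hf : IsSolution A f)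
    (hsep : IsUniformlySeparated (diskZeros f)) :
    (∃ B g : ℂ → ℂ, IsBlaschkeBlochFactorization f B g) ∧
      ∀ B g : ℂ → ℂ, IsBlaschkeBlochFactorization f B g →
        ∀ p : ℝ, 0 < p →
          BddAbove ((fun r : ℝ => integralMean p r f * (1 - r) ^ (p * blochNorm g ^ 2)) ''
            Set.Ioo 0 1) := by
  refine ⟨hf.exists_factorization hA hsep, fun B g h p hp => ?_⟩
  refine ⟨(‖Complex.exp (p / 2 * g 0)‖ ^ 2) ^ (1 / p), ?_⟩
  rintro _ ⟨r, hr, rfl⟩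
  exact h.integralMean_mul_rpow_le hf.1 hp hr
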